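/- Let $n\ge 1$, let $\lambda=(\lambda_1,\dots,\lambda_n)\in(-1/2,\infty)^n$ and let $d\mu_\lambda(x)=\prod_{j=1}^n x_j^{2\lambda_j}\,dx_j$ on $(0,\infty)^n$. For $a>-1/2$ and $t,x,y>0$ let $$L_t^{a}(x,y)=\frac{e^{-t}}{1-e^{-2t}}\,(xy)^{-a+1/2}\,I_{a-1/2}\!\left(\frac{e^{-t}xy}{1-e^{-2t}}\right)\exp\!\left(-\frac14\,\frac{1+e^{-2t}}{1-e^{-2t}}\,(x^2+y^2)\right)$$ be the Laguerre heat kernel, where $I_\nu$ is the modified Bessel function of the first kind and order $\nu$. Let $r=(r_1,\dots,r_n)$, where each $r_j:[0,\infty)\to[0,\infty)$ is continuous and increasing (in the wide sense, with $r_j(t)>0$ for $t>0$), $r_j(0)=0$ and $\lim_{t\to+\infty}r_j(t)=+\infty$. For $f\in L^p((0,\infty)^n,d\mu_\lambda)$, $1\le p\le\infty$, and $x\in(0,\infty)^n$ put $$\mathbb L^\lambda_{r(t)}f(x)=\int_{(0,\infty)^n}\prod_{j=1}^n L^{\lambda_j}_{r_j(t)}(x_j,y_j)\,f(y)\,d\mu_\lambda(y)\quad(t>0),\qquad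 \mathbb L^\lambda_{r,*}f(x)=\sup_{t>0}\bigl|\mathbb L^\lambda_{r(t)}f(x)\bigr|.$$ **Theorem.** For every such $f$, $x$ and $t$ the integral defining $\mathbb L^\lambda_{r(t)}f(x)$ converges absolutely. The maximal operator $\mathbb L^\lambda_{r,*}$ is bounded from $L^p((0,\infty)^n,d\mu_\lambda)$ into itself for every $1<p\le\infty$, and from $L^1((0,\infty)^n,d\mu_\lambda)$ into $L^{1,\infty}((0,\infty)^n,d\mu_\lambda)$. That is, for every $f\in L^p$ (respectively $f\in L^1$) the function $\mathbb L^\lambda_{r,*}f$ is $\mu_\lambda$-measurable, and there are constants $C_p<\infty$ $(1<p\le\infty)$ and $C_1<\infty$, independent of $f$, such that $$\|\mathbb L^\lambda_{r,*}f\|_{L^p(d\mu_\lambda)}\le C_p\,\|f\|_{L^p(d\mu_\lambda)}\quad\text{for all } f\in L^p(d\mu_\lambda),\ 1<p\le\infty,$$ $$\mu_\lambda\bigl(\{x\in(0,\infty)^n:\ \mathbb L^\lambda_{r,*}f(x)>\alpha\}\bigr)\le \frac{C_1}{\alpha}\,\|f\|_{L^1(d\mu_\lambda)}\quad\text{for all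 } f\in L^1(d\mu_\lambda),\ \alpha>0.$$ -/

import Mathlib

open MeasureTheory Set Filter Topology
open scoped NNReal ENNReal

noncomputable section

/-- The modified Bessel function of the first kind `I_ν(z)`, for real order `ν > -1` and `z > 0`,
by its (everywhere convergent) power series. -/
def besselI (ν z : ℝ) : ℝ :=
  ∑' k : ℕ, (z / 2) ^ (2 * (k : ℝ) + ν) / ((k.factorial : ℝ) * Real.Gamma ((k : ℝ) + ν + 1))

/-- The one-dimensional Laguerre heat kernel `L_t^a(x, y)`, for `a > -1/2` and `t, x, y > 0`. -/
def laguerreKernel1 (a t x y : ℝ) : ℝ :=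
  Real.exp (-t) / (1 - Real.exp (-2 * t)) * (x * y) ^ (-a + 1 / 2) *
    besselI (a - 1 / 2) (Real.exp (-t) * (x * y) / (1 - Real.exp (-2 * t))) *
    Real.exp (-(1 / 4) * ((1 + Real.exp (-2 * t)) / (1 - Real.exp (-2 * t))) * (x ^ 2 + y ^ 2))

/-- The measure `x^{2a} dx` on `(0, ∞)`, as a measure on `ℝ` carried by `(0, ∞)`. -/
def powerMeasure (a : ℝ) : Measure ℝ :=
  (volume.restrict (Ioi (0 : ℝ))).withDensity fun x => ENNReal.ofReal (x ^ (2 * a))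

instance powerMeasure_sigmaFinite (a : ℝ) : SigmaFinite (powerMeasure a) := by
  unfold powerMeasure
  exact SigmaFinite.withDensity_ofReal _

/-- The product measure `dμ_lam(x) = ∏_j x_j^{2 lam_j} dx_j` on `(0, ∞)^n`,
as a measure on `ℝ^n` carried by `(0, ∞)^n`. -/
def laguerreMeasure {n : ℕ} (lam : Fin n → ℝ) : Measure (Fin n → ℝ) :=
  Measure.pi fun j => powerMeasure (lam j)

/-- The product kernel `∏_j L_{s_j}^{lam_j}(x_j, y_j)`, with a time `s_j` for each variable. -/
def laguerreKernel {n : ℕ} (lam s x y : Fin n → ℝ) : ℝ :=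
  ∏ j, laguerreKernel1 (lam j) (s j) (x j) (y j)

/-- The integral operator with kernel `laguerreKernel lam s` with respect to `μ_lam`. -/
def laguerreHeat {𝕜 : Type*} [RCLike 𝕜] {n : ℕ} (lam s : Fin n → ℝ)
    (f : (Fin n → ℝ) → 𝕜) (x : Fin n → ℝ) : 𝕜 :=
  ∫ y, laguerreKernel lam s x y • f y ∂(laguerreMeasure lam)

/-- The generalized maximal operator `sup_{t > 0} |L_{r(t)}^lam f|`, with values in `[0, ∞]`. -/
def laguerreMaximal {𝕜 : Type*} [RCLike 𝕜] {n : ℕ} (lam : Fin n → ℝ) (r : Fin n → ℝ≥0 → ℝ≥0)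
    (f : (Fin n → ℝ) → 𝕜) (x : Fin n → ℝ) : ℝ≥0∞ :=
  ⨆ t : ℝ≥0, ⨆ _ : 0 < t, ‖laguerreHeat lam (fun j => (r j t : ℝ)) f x‖ₑ

/-- The admissible time changes `ρ : [0, ∞) → [0, ∞)`: continuous, increasing, `ρ(0) = 0` and
`ρ(t) → ∞` as `t → ∞`. "Increasing" is in the wide sense, with `ρ(t) > 0` for `t > 0` (automatic
for a strictly increasing `ρ`), since the heat kernel is defined at positive times only. -/
structure IsTimeChange (ρ : ℝ≥0 → ℝ≥0) : Prop where
  continuous : Continuous ρ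
  monotone : Monotone ρ
  map_zero : ρ 0 = 0
  pos : ∀ t, 0 < t → 0 < ρ t
  tendsto : Tendsto ρ atTop atTop

end

/-! In one variable put ρ = √(tanh (t/2)), the `heatScale` of t. The interval (x - ρ, x + ρ) has
measure comparable to ρ (x + ρ)^{2a}, and the kernel at time t is at most a constant divided by this
quantity, times (1 + |x - y|/ρ)^{-N}, for any fixed N and uniformly in t > 0
(`exists_laguerreKernel1_le`). This rests on the growth of the Bessel series
(`exists_besselSeries_le`), whose exponential completes the square in the Gaussian factor, and on
hyperbolic identities that let one scale ρ ≤ 1 serve both small and large times.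

In n variables the decay beats the polynomial growth of the measure of dilated boxes. Hence the
integral of the kernel against |f| is at most a constant times a sum over k of 4^{-k} times the
average of |f| over the box centred at x with half sides 2^k ρ_j
(`exists_lintegral_boxDecay_mul_le`). Arbitrary boxes would lead to the strong maximal function,
which is not of weak type (1,1) when n ≥ 2. Here every side increases with the same parameter t, so
any two shapes are comparable side by side, and Vitali's covering argument with doubling works as it
does for balls (`mul_measure_exists_average_gt_le`). The weights leave room to sum over k
(`mul_measure_exists_dyadicAverage_gt_le`).

Cutting f at a height gives a weak type estimate that involves only the large part of f. It contains
the weak (1,1) bound, and integrating it over heights gives L^p for 1 < p < ∞; the case p = ∞ is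
immediate for averages. Measurability holds because the maximal function is a supremum of functions
continuous on the orthant. -/

noncomputable section

/-! ### Growth of the Bessel series -/

/-- The entire function `∑ (z/2)^{2k} / (k! Γ(k+s))`, which is `(z/2)^{-ν} I_ν(z)`, `s = ν + 1`. -/
def besselSeries (s z : ℝ) : ℝ :=
  ∑' k : ℕ, (z / 2) ^ (2 * k) / ((k.factorial : ℝ) * Real.Gamma ((k : ℝ) + s))

theorem prod_add_mul_Gamma {s : ℝ} (hs : 0 < s) (n : ℕ) :
    (∏ j ∈ Finset.range n, (s + j)) * Real.Gamma s = Real.Gamma (s + n) := by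
  induction n with
  | zero => simp
  | succ n ih =>
    rw [Finset.prod_range_succ, mul_right_comm, ih, mul_comm, ← Real.Gamma_add_one (by positivity)]
    push_cast
    ring_nf

/-- Euler's sequence for Γ(s) converges, hence is bounded; its denominator is Γ(s + k + 1)/Γ(s), so
the bound on the sequence is a lower bound for Γ(k + s). -/
theorem exists_inv_Gamma_add_le {s : ℝ} (hs : 0 < s) :
    ∃ C : ℝ, 0 < C ∧ ∀ k : ℕ,
      1 / Real.Gamma ((k : ℝ) + s) ≤ C * ((k : ℝ) + 1) ^ (1 - s) / (k.factorial : ℝ) := by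
  obtain ⟨B, hB⟩ := (Real.GammaSeq_tendsto_Gamma s).bddAbove_range
  have hG := Real.Gamma_pos_of_pos hs
  refine ⟨max 1 B / Real.Gamma s * ((s + 1) * 2 ^ s), by positivity, fun k => ?_⟩
  have hGk : 0 < Real.Gamma ((k : ℝ) + s) := Real.Gamma_pos_of_pos (by positivity)
  have hB1 : (1 : ℝ) ≤ max 1 B := le_max_left _ _
  -- Euler's sequence carries the factor k^s, which vanishes at k = 0, so this index is checked by
  -- hand.
  rcases Nat.eq_zero_or_pos k with rfl | hk
  · have h2 : (1 : ℝ) ≤ 2 ^ s := Real.one_le_rpow (by norm_num) hs.le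
    simp only [Nat.cast_zero, zero_add, Real.one_rpow, mul_one, Nat.factorial_zero, Nat.cast_one,
      div_one]
    rw [div_mul_eq_mul_div]
    gcongr
    exact one_le_mul_of_one_le_of_one_le hB1
      (one_le_mul_of_one_le_of_one_le (by linarith) h2)
  · have hk0 : (0 : ℝ) < k := by exact_mod_cast hk
    have hk1 : (1 : ℝ) ≤ k := by exact_mod_cast hk
    have hseq : Real.GammaSeq s k ≤ max 1 B := (hB ⟨k, rfl⟩).trans (le_max_right _ _)
    have hprod := prod_add_mul_Gamma hs (k + 1)
    have e1 : Real.Gamma (s + ((k + 1 : ℕ) : ℝ)) = (k + s) * Real.Gamma (k + s) := by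
      rw [← Real.Gamma_add_one (by positivity)]
      push_cast
      ring_nf
    have hpp : 0 < ∏ j ∈ Finset.range (k + 1), (s + (j : ℝ)) :=
      Finset.prod_pos fun j _ => by positivity
    rw [Real.GammaSeq, div_le_iff₀ hpp] at hseq
    have hps : ∏ j ∈ Finset.range (k + 1), (s + (j : ℝ)) =
        (k + s) * Real.Gamma (k + s) / Real.Gamma s := by
      rw [← e1, ← hprod, mul_div_cancel_right₀ _ hG.ne']
    rw [hps] at hseq
    have hf : (0 : ℝ) < k.factorial := by positivity
    have hks : (0 : ℝ) < (k : ℝ) ^ s := by positivity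
    have h1 : (k.factorial : ℝ) / Real.Gamma (k + s) ≤
        max 1 B / Real.Gamma s * ((k + s) / (k : ℝ) ^ s) := by
      rw [div_mul_div_comm, div_le_div_iff₀ hGk (by positivity)]
      calc (k.factorial : ℝ) * (Real.Gamma s * (k : ℝ) ^ s)
          = ((k : ℝ) ^ s * k.factorial) * Real.Gamma s := by ring
        _ ≤ (max 1 B * ((k + s) * Real.Gamma (k + s) / Real.Gamma s)) * Real.Gamma s := by gcongr
        _ = _ := by field_simp
    have h2 : (k + s) / (k : ℝ) ^ s ≤ ((s + 1) * 2 ^ s) * ((k : ℝ) + 1) ^ (1 - s) := by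
      rw [Real.rpow_sub (by positivity), Real.rpow_one, mul_div_assoc', div_le_div_iff₀ hks
        (by positivity)]
      have h3 : ((k : ℝ) + 1) ^ s ≤ 2 ^ s * (k : ℝ) ^ s := by
        rw [← Real.mul_rpow (by norm_num) hk0.le]
        exact Real.rpow_le_rpow (by positivity) (by linarith) hs.le
      have h4 : (k : ℝ) + s ≤ (s + 1) * (k + 1) := by nlinarith
      calc ((k : ℝ) + s) * ((k : ℝ) + 1) ^ s ≤ ((s + 1) * (k + 1)) * (2 ^ s * (k : ℝ) ^ s) := by
            gcongr
        _ = _ := by ring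
    rw [div_le_div_iff₀ hGk hf, one_mul]
    rw [div_le_iff₀ hGk] at h1
    refine h1.trans ?_
    rw [mul_assoc (max 1 B / Real.Gamma s) ((s + 1) * 2 ^ s)]
    exact mul_le_mul_of_nonneg_right (mul_le_mul_of_nonneg_left h2 (by positivity)) hGk.le

theorem centralBinom_sq_mul_le (k : ℕ) : k.centralBinom ^ 2 * (2 * k + 1) ≤ 16 ^ k := by
  induction k with
  | zero => simp
  | succ k ih =>
    have h := Nat.succ_mul_centralBinom_succ k
    have h2 : (k + 1) ^ 2 * ((k + 1).centralBinom ^ 2 * (2 * (k + 1) + 1)) ≤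
        (k + 1) ^ 2 * 16 ^ (k + 1) := by
      calc (k + 1) ^ 2 * ((k + 1).centralBinom ^ 2 * (2 * (k + 1) + 1))
          = ((k + 1) * (k + 1).centralBinom) ^ 2 * (2 * (k + 1) + 1) := by ring
        _ = (k.centralBinom ^ 2 * (2 * k + 1)) * (4 * ((2 * k + 1) * (2 * k + 3))) := by
            rw [h]; ring
        _ ≤ 16 ^ k * (4 * (4 * (k + 1) ^ 2)) := by
            refine Nat.mul_le_mul ih (Nat.mul_le_mul_left 4 ?_)
            nlinarith
        _ = _ := by ring
    exact Nat.le_of_mul_le_mul_left h2 (by positivity)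

/-- The left side is the central binomial coefficient over (2k)!, and that coefficient is O(4^k /
√(k+1)). Only the even terms of the exponential series then remain to be compared. -/
theorem one_div_factorial_sq_le (k : ℕ) :
    1 / ((k.factorial : ℝ) * k.factorial) ≤
      4 ^ k / ((2 * k).factorial : ℝ) * ((k : ℝ) + 1) ^ (-(1 / 2) : ℝ) := by
  have hc : (k.centralBinom : ℝ) * (k.factorial * k.factorial) = (2 * k).factorial := by
    have h := Nat.choose_mul_factorial_mul_factorial (show k ≤ 2 * k by omega)
    rw [show 2 * k - k = k by omega, ← Nat.centralBinom_eq_two_mul_choose] at h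
    rw [← h]
    push_cast
    ring
  have h4 : (k.centralBinom : ℝ) * √((k : ℝ) + 1) ≤ 4 ^ k := by
    have h := centralBinom_sq_mul_le k
    have h' : (k.centralBinom : ℝ) ^ 2 * (2 * k + 1) ≤ 16 ^ k := by exact_mod_cast h
    refine (pow_le_pow_iff_left₀ (by positivity) (by positivity) two_ne_zero).1 ?_
    rw [mul_pow, Real.sq_sqrt (by positivity), ← pow_mul, mul_comm k 2, pow_mul]
    norm_num
    refine le_trans ?_ h'
    gcongr
    linarith [(Nat.cast_nonneg k : (0 : ℝ) ≤ k)]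
  rw [Real.rpow_neg (by positivity), ← Real.sqrt_eq_rpow, ← hc]
  have hcb : (0 : ℝ) < k.centralBinom := by exact_mod_cast Nat.centralBinom_pos k
  have hf : (0 : ℝ) < k.factorial := by positivity
  have hq : 0 < √((k : ℝ) + 1) := by positivity
  rw [← div_eq_mul_inv, div_div, div_le_div_iff₀ (by positivity) (by positivity)]
  nlinarith [mul_le_mul_of_nonneg_right h4 (mul_pos hf hf).le]

theorem exists_besselSeries_term_le {s : ℝ} (hs : 0 < s) :
    ∃ C : ℝ, 0 < C ∧ ∀ (k : ℕ) (z : ℝ), 0 ≤ z →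
      (z / 2) ^ (2 * k) / ((k.factorial : ℝ) * Real.Gamma ((k : ℝ) + s)) ≤
        C * (z ^ (2 * k) / ((2 * k).factorial : ℝ) * ((k : ℝ) + 1) ^ (1 / 2 - s)) := by
  obtain ⟨C, hC, h⟩ := exists_inv_Gamma_add_le hs
  refine ⟨C, hC, fun k z hz => ?_⟩
  have e : ((k : ℝ) + 1) ^ (1 / 2 - s) = ((k : ℝ) + 1) ^ (1 - s) * ((k : ℝ) + 1) ^ (-(1 / 2) : ℝ) := by
    rw [← Real.rpow_add (by positivity)]
    ring_nf
  have e2 : (z / 2) ^ (2 * k) = z ^ (2 * k) / 4 ^ k := by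
    rw [div_pow, pow_mul 2 2 k]
    norm_num
  calc (z / 2) ^ (2 * k) / ((k.factorial : ℝ) * Real.Gamma ((k : ℝ) + s))
      = z ^ (2 * k) / 4 ^ k / k.factorial * (1 / Real.Gamma ((k : ℝ) + s)) := by
        rw [e2]; field_simp
    _ ≤ z ^ (2 * k) / 4 ^ k / k.factorial * (C * ((k : ℝ) + 1) ^ (1 - s) / (k.factorial : ℝ)) := by
        exact mul_le_mul_of_nonneg_left (h k) (by positivity)
    _ = z ^ (2 * k) / 4 ^ k * (C * ((k : ℝ) + 1) ^ (1 - s)) *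
        (1 / ((k.factorial : ℝ) * k.factorial)) := by field_simp
    _ ≤ z ^ (2 * k) / 4 ^ k * (C * ((k : ℝ) + 1) ^ (1 - s)) *
        (4 ^ k / ((2 * k).factorial : ℝ) * ((k : ℝ) + 1) ^ (-(1 / 2) : ℝ)) := by
        gcongr
        exact one_div_factorial_sq_le k
    _ = _ := by rw [e]; field_simp

theorem hasSum_pow_div_factorial (z : ℝ) :
    HasSum (fun m : ℕ => z ^ m / (m.factorial : ℝ)) (Real.exp z) := by
  rw [Real.exp_eq_exp_ℝ]
  exact NormedSpace.expSeries_div_hasSum_exp z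

theorem hasSum_pow_div_factorial_mul_add_one (z : ℝ) :
    HasSum (fun m : ℕ => z ^ m / (m.factorial : ℝ) * ((m : ℝ) + 1)) ((1 + z) * Real.exp z) := by
  have h1 : HasSum (fun m : ℕ => z ^ m / (m.factorial : ℝ) * (m : ℝ)) (z * Real.exp z) := by
    rw [← hasSum_nat_add_iff' 1]
    simp only [Finset.range_one, Finset.sum_singleton, Nat.cast_zero, mul_zero, sub_zero]
    refine ((hasSum_pow_div_factorial z).mul_left z).congr_fun fun m => ?_
    rw [Nat.factorial_succ, pow_succ]
    push_cast
    field_simp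
  convert h1.add (hasSum_pow_div_factorial z) using 2 with m
  · ring
  · ring

/-- Majorant for the Poisson moments: dominates `z^m/m! ⋅ (x + x^{-N})` with `x = (m+1)/(1+z)`. -/
def poissonMajorant (N : ℕ) (z : ℝ) (m : ℕ) : ℝ :=
  (1 / (1 + z)) * (z ^ m / (m.factorial : ℝ) * ((m : ℝ) + 1)) +
    (2 ^ N * (z ^ m / (m.factorial : ℝ)) +
      2 ^ N * (N + 1) ^ N * (z ^ (m + N) / ((m + N).factorial : ℝ)))

theorem poissonMajorant_nonneg (N : ℕ) {z : ℝ} (hz : 0 ≤ z) (m : ℕ) :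
    0 ≤ poissonMajorant N z m := by
  unfold poissonMajorant
  positivity

theorem summable_poissonMajorant (N : ℕ) {z : ℝ} (hz : 0 ≤ z) :
    Summable (poissonMajorant N z) ∧
      ∑' m, poissonMajorant N z m ≤ (1 + 2 ^ N + 2 ^ N * (N + 1) ^ N) * Real.exp z := by
  have h1 := (hasSum_pow_div_factorial_mul_add_one z).mul_left (1 / (1 + z))
  have h0 := hasSum_pow_div_factorial z
  have h3 : Summable fun m : ℕ => z ^ (m + N) / ((m + N).factorial : ℝ) :=
    (summable_nat_add_iff N).2 h0.summable
  have h4 : ∑' m : ℕ, z ^ (m + N) / ((m + N).factorial : ℝ) ≤ Real.exp z := by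
    rw [← h0.tsum_eq, ← h0.summable.sum_add_tsum_nat_add N]
    have : 0 ≤ ∑ i ∈ Finset.range N, z ^ i / (i.factorial : ℝ) :=
      Finset.sum_nonneg fun i _ => by positivity
    linarith
  have h5 := h1.add ((h0.mul_left (2 ^ N)).add (h3.hasSum.mul_left (2 ^ N * ((N : ℝ) + 1) ^ N)))
  refine ⟨h5.summable, ?_⟩
  refine h5.tsum_eq.trans_le ?_
  have h6 : 1 / (1 + z) * ((1 + z) * Real.exp z) = Real.exp z := by
    field_simp
  rw [h6]
  have h7 : (2 : ℝ) ^ N * ((N : ℝ) + 1) ^ N * ∑' m : ℕ, z ^ (m + N) / ((m + N).factorial : ℝ) ≤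
      2 ^ N * ((N : ℝ) + 1) ^ N * Real.exp z := by gcongr
  linarith

/-- Negative powers of m + 1 are traded for a shift of the factorial, so that negative Poisson
moments become tails of the exponential series. -/
theorem inv_add_one_pow_le (N m : ℕ) :
    1 / ((m : ℝ) + 1) ^ N ≤ (N + 1) ^ N * (m.factorial / ((m + N).factorial : ℝ)) := by
  have h1 : (m + N).factorial ≤ m.factorial * ((N + 1) * (m + 1)) ^ N := by
    rw [← Nat.factorial_mul_ascFactorial]
    gcongr
    refine (Nat.ascFactorial_le_pow_add m N).trans ?_
    gcongr
    nlinarith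
  have h2 : ((m + N).factorial : ℝ) ≤ m.factorial * ((N + 1) * (m + 1)) ^ N := by
    exact_mod_cast h1
  rw [mul_pow] at h2
  rw [mul_div_assoc', div_le_div_iff₀ (by positivity) (by positivity)]
  linarith

theorem one_add_pow_le {z : ℝ} (hz : 0 ≤ z) (N : ℕ) : (1 + z) ^ N ≤ 2 ^ N * (1 + z ^ N) := by
  rcases le_total z 1 with h | h
  · calc (1 + z) ^ N ≤ 2 ^ N := by gcongr; linarith
      _ ≤ _ := le_mul_of_one_le_right (by positivity) (by linarith [pow_nonneg hz N])
  · calc (1 + z) ^ N ≤ (2 * z) ^ N := by gcongr; linarith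
      _ = 2 ^ N * z ^ N := mul_pow _ _ _
      _ ≤ _ := by gcongr; linarith

theorem rpow_le_add_inv_pow {x b : ℝ} (hx : 0 < x) {N : ℕ} (h1 : b ≤ 1) (h2 : -(N : ℝ) ≤ b) :
    x ^ b ≤ x + 1 / x ^ N := by
  have hN : x ^ (-(N : ℝ)) = 1 / x ^ N := by
    rw [Real.rpow_neg hx.le, Real.rpow_natCast, one_div]
  rcases le_total 1 x with h | h
  · have := Real.rpow_le_rpow_of_exponent_le h h1
    rw [Real.rpow_one] at this
    have : 0 ≤ 1 / x ^ N := by positivity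
    linarith
  · have := Real.rpow_le_rpow_of_exponent_ge hx h h2
    rw [hN] at this
    linarith

/-- The weights z^m/m! concentrate where m is of order z, so (m+1)^b should act like (1+z)^b. With x
= (m+1)/(1+z), the power x^b is at most x + x^{-N}, and both of these moments can be summed. -/
theorem pow_div_factorial_mul_rpow_le {z b : ℝ} (hz : 0 ≤ z) {N : ℕ} (h1 : b ≤ 1)
    (h2 : -(N : ℝ) ≤ b) (m : ℕ) :
    z ^ m / (m.factorial : ℝ) * ((m : ℝ) + 1) ^ b ≤ (1 + z) ^ b * poissonMajorant N z m := by
  have hz1 : 0 < 1 + z := by linarith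
  have hm : (0 : ℝ) < (m : ℝ) + 1 := by positivity
  have hx := rpow_le_add_inv_pow (x := ((m : ℝ) + 1) / (1 + z)) (by positivity) h1 h2
  have e : ((m : ℝ) + 1) ^ b = (1 + z) ^ b * (((m : ℝ) + 1) / (1 + z)) ^ b := by
    rw [Real.div_rpow hm.le hz1.le]
    field_simp
  rw [e, mul_left_comm]
  gcongr
  calc z ^ m / (m.factorial : ℝ) * (((m : ℝ) + 1) / (1 + z)) ^ b
      ≤ z ^ m / (m.factorial : ℝ) * (((m : ℝ) + 1) / (1 + z) + 1 / (((m : ℝ) + 1) / (1 + z)) ^ N) := by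
        gcongr
    _ = (1 / (1 + z)) * (z ^ m / (m.factorial : ℝ) * ((m : ℝ) + 1)) +
        z ^ m / (m.factorial : ℝ) * (1 / ((m : ℝ) + 1) ^ N) * (1 + z) ^ N := by
        rw [div_pow]; field_simp
    _ ≤ _ := by
        unfold poissonMajorant
        gcongr
        calc z ^ m / (m.factorial : ℝ) * (1 / ((m : ℝ) + 1) ^ N) * (1 + z) ^ N
            ≤ z ^ m / (m.factorial : ℝ) * (1 / ((m : ℝ) + 1) ^ N) * (2 ^ N * (1 + z ^ N)) := by
              gcongr
              exact one_add_pow_le hz N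
          _ = 2 ^ N * (z ^ m / (m.factorial : ℝ) * (1 / ((m : ℝ) + 1) ^ N)) +
              2 ^ N * z ^ N * (z ^ m / (m.factorial : ℝ)) * (1 / ((m : ℝ) + 1) ^ N) := by ring
          _ ≤ 2 ^ N * (z ^ m / (m.factorial : ℝ) * 1) +
              2 ^ N * z ^ N * (z ^ m / (m.factorial : ℝ)) *
              ((N + 1) ^ N * (m.factorial / ((m + N).factorial : ℝ))) := by
              gcongr
              · rw [div_le_one (by positivity)]
                exact one_le_pow₀ (by linarith [(Nat.cast_nonneg m : (0 : ℝ) ≤ m)])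
              · exact inv_add_one_pow_le N m
          _ = _ := by
              rw [pow_add]
              field_simp

theorem exists_besselSeries_term_le_majorant {s : ℝ} (hs : 0 < s) :
    ∃ (C : ℝ) (N : ℕ), 0 < C ∧ ∀ (k : ℕ) (z : ℝ), 0 ≤ z →
      (z / 2) ^ (2 * k) / ((k.factorial : ℝ) * Real.Gamma ((k : ℝ) + s)) ≤
        C * (1 + z) ^ (1 / 2 - s) * poissonMajorant N z (2 * k) := by
  obtain ⟨C, hC, h⟩ := exists_besselSeries_term_le hs
  obtain ⟨N, hN⟩ := exists_nat_ge s
  refine ⟨C * 2 ^ |1 / 2 - s|, N, by positivity, fun k z hz => (h k z hz).trans ?_⟩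
  have hk : ((k : ℝ) + 1) ^ (1 / 2 - s) ≤
      2 ^ |1 / 2 - s| * (((2 * k : ℕ) : ℝ) + 1) ^ (1 / 2 - s) := by
    have hk0 : (0 : ℝ) ≤ k := Nat.cast_nonneg k
    push_cast
    rcases le_total 0 (1 / 2 - s) with hb | hb
    · calc ((k : ℝ) + 1) ^ (1 / 2 - s) ≤ (2 * (k : ℝ) + 1) ^ (1 / 2 - s) :=
            Real.rpow_le_rpow (by positivity) (by linarith) hb
        _ ≤ _ := le_mul_of_one_le_left (by positivity)
            (Real.one_le_rpow (by norm_num) (abs_nonneg _))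
    · rw [abs_of_nonpos hb, Real.rpow_neg (by norm_num), ← div_eq_inv_mul,
        ← Real.div_rpow (by positivity) (by norm_num)]
      exact Real.rpow_le_rpow_of_nonpos (by positivity) (by linarith) hb
  have h2 := pow_div_factorial_mul_rpow_le hz (N := N) (b := 1 / 2 - s) (by linarith)
    (by linarith) (2 * k)
  calc C * (z ^ (2 * k) / ((2 * k).factorial : ℝ) * ((k : ℝ) + 1) ^ (1 / 2 - s))
      ≤ C * (z ^ (2 * k) / ((2 * k).factorial : ℝ) *
        (2 ^ |1 / 2 - s| * (((2 * k : ℕ) : ℝ) + 1) ^ (1 / 2 - s))) := by gcongr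
    _ = C * 2 ^ |1 / 2 - s| * (z ^ (2 * k) / ((2 * k).factorial : ℝ) *
        (((2 * k : ℕ) : ℝ) + 1) ^ (1 / 2 - s)) := by ring
    _ ≤ C * 2 ^ |1 / 2 - s| * ((1 + z) ^ (1 / 2 - s) * poissonMajorant N z (2 * k)) := by gcongr
    _ = _ := by ring

theorem besselSeries_term_nonneg {s : ℝ} (hs : 0 < s) {z : ℝ} (hz : 0 ≤ z) (k : ℕ) :
    0 ≤ (z / 2) ^ (2 * k) / ((k.factorial : ℝ) * Real.Gamma ((k : ℝ) + s)) := by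
  have := Real.Gamma_pos_of_pos (show 0 < (k : ℝ) + s by positivity)
  positivity

theorem besselSeries_nonneg {s : ℝ} (hs : 0 < s) {z : ℝ} (hz : 0 ≤ z) : 0 ≤ besselSeries s z :=
  tsum_nonneg fun k => besselSeries_term_nonneg hs hz k

theorem summable_comp_two_mul_poissonMajorant (N : ℕ) {z : ℝ} (hz : 0 ≤ z) :
    Summable fun k : ℕ => poissonMajorant N z (2 * k) :=
  (summable_poissonMajorant N hz).1.comp_injective fun a b hab => by simpa using hab

theorem summable_besselSeries {s : ℝ} (hs : 0 < s) {z : ℝ} (hz : 0 ≤ z) :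
    Summable fun k : ℕ => (z / 2) ^ (2 * k) / ((k.factorial : ℝ) * Real.Gamma ((k : ℝ) + s)) := by
  obtain ⟨C, N, hC, h⟩ := exists_besselSeries_term_le_majorant hs
  exact Summable.of_nonneg_of_le (besselSeries_term_nonneg hs hz) (fun k => h k z hz)
    ((summable_comp_two_mul_poissonMajorant N hz).mul_left _)

/-- This is the true order of growth, I_ν(z) ~ e^z/√(2πz), in a form that is also valid near z = 0.
The terms are dominated by the even-indexed part of a Poisson moment of exponent 1/2 - s. -/
theorem exists_besselSeries_le {s : ℝ} (hs : 0 < s) :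
    ∃ C : ℝ, 0 < C ∧ ∀ z : ℝ, 0 ≤ z →
      besselSeries s z ≤ C * (1 + z) ^ (1 / 2 - s) * Real.exp z := by
  obtain ⟨C, N, hC, h⟩ := exists_besselSeries_term_le_majorant hs
  refine ⟨C * (1 + 2 ^ N + 2 ^ N * (N + 1) ^ N), by positivity, fun z hz => ?_⟩
  have hinj : Function.Injective fun k : ℕ => 2 * k := fun a b hab => by simpa using hab
  have h1 := (summable_besselSeries hs hz).tsum_le_tsum (fun k => h k z hz)
    ((summable_comp_two_mul_poissonMajorant N hz).mul_left _)
  rw [tsum_mul_left] at h1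
  have h2 : ∑' k : ℕ, poissonMajorant N z (2 * k) ≤ ∑' m, poissonMajorant N z m :=
    tsum_comp_le_tsum_of_inj (summable_poissonMajorant N hz).1
      (fun m => poissonMajorant_nonneg N hz m) hinj
  have h3 := h2.trans (summable_poissonMajorant N hz).2
  have h4 : 0 ≤ C * (1 + z) ^ (1 / 2 - s) := by positivity
  refine h1.trans ((mul_le_mul_of_nonneg_left h3 h4).trans_eq ?_)
  ring

theorem continuous_besselSeries {s : ℝ} (hs : 0 < s) : Continuous (besselSeries s) := by
  refine continuous_iff_continuousAt.2 fun z₀ => ?_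
  have hR : 0 ≤ |z₀| + 1 := by positivity
  have hc : ContinuousOn (besselSeries s) (Metric.closedBall 0 (|z₀| + 1)) := by
    refine continuousOn_tsum (fun k => by fun_prop) (summable_besselSeries hs hR)
      fun k z hz => ?_
    have hG := Real.Gamma_pos_of_pos (show 0 < (k : ℝ) + s by positivity)
    rw [mem_closedBall_zero_iff, Real.norm_eq_abs] at hz
    rw [norm_div, norm_pow, Real.norm_of_nonneg (by positivity :
      0 ≤ (k.factorial : ℝ) * Real.Gamma (k + s)), norm_div, Real.norm_eq_abs, Real.norm_eq_abs,
      abs_two]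
    gcongr
  refine hc.continuousAt (Metric.closedBall_mem_nhds_of_mem ?_)
  rw [mem_ball_zero_iff, Real.norm_eq_abs]
  linarith

theorem besselI_eq_rpow_mul_besselSeries (ν : ℝ) {z : ℝ} (hz : 0 < z) :
    besselI ν z = (z / 2) ^ ν * besselSeries (ν + 1) z := by
  rw [besselI, besselSeries, ← tsum_mul_left]
  refine tsum_congr fun k => ?_
  rw [Real.rpow_add (by positivity), show (2 * (k : ℝ)) = ((2 * k : ℕ) : ℝ) by push_cast; rfl,
    Real.rpow_natCast, ← add_assoc]
  ring

/-! ### Pointwise bound for the one-dimensional kernel -/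

/-- The spatial scale `√(tanh (t/2))` of the Laguerre heat kernel at time `t`. -/
def heatScale (t : ℝ) : ℝ := √((1 - Real.exp (-t)) / (1 + Real.exp (-t)))

/-- The factor `1 / (2 sinh t)`. -/
def heatFactor (t : ℝ) : ℝ := Real.exp (-t) / (1 - Real.exp (-2 * t))

theorem exp_neg_two_mul (t : ℝ) : Real.exp (-2 * t) = Real.exp (-t) ^ 2 := by
  rw [← Real.exp_nat_mul]
  congr 1
  push_cast
  ring

theorem heatFactor_pos {t : ℝ} (ht : 0 < t) : 0 < heatFactor t := by
  have : Real.exp (-2 * t) < 1 := Real.exp_lt_one_iff.2 (by linarith)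
  exact div_pos (Real.exp_pos _) (by linarith)

theorem heatScale_sq {t : ℝ} (ht : 0 < t) :
    heatScale t ^ 2 = (1 - Real.exp (-t)) / (1 + Real.exp (-t)) := by
  have : Real.exp (-t) < 1 := Real.exp_lt_one_iff.2 (by linarith)
  exact Real.sq_sqrt (div_nonneg (by linarith) (by positivity))

theorem heatScale_pos {t : ℝ} (ht : 0 < t) : 0 < heatScale t := by
  have : Real.exp (-t) < 1 := Real.exp_lt_one_iff.2 (by linarith)
  exact Real.sqrt_pos.2 (div_pos (by linarith) (by positivity))

theorem heatScale_le_one (t : ℝ) : heatScale t ≤ 1 := by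
  refine Real.sqrt_le_one.2 ?_
  have := Real.exp_pos (-t)
  rw [div_le_one (by positivity)]
  linarith

theorem heatScale_mono : Monotone heatScale := by
  intro s t h
  refine Real.sqrt_le_sqrt ?_
  have h1 : Real.exp (-t) ≤ Real.exp (-s) := Real.exp_le_exp.2 (by linarith)
  have := Real.exp_pos (-t)
  have := Real.exp_pos (-s)
  rw [div_le_div_iff₀ (by positivity) (by positivity)]
  nlinarith

theorem four_mul_heatFactor {t : ℝ} (ht : 0 < t) :
    4 * heatFactor t = 1 / heatScale t ^ 2 - heatScale t ^ 2 := by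
  have h1 : Real.exp (-t) < 1 := Real.exp_lt_one_iff.2 (by linarith)
  rw [heatScale_sq ht, heatFactor, exp_neg_two_mul]
  have h2 : 1 - Real.exp (-t) ≠ 0 := by linarith
  have h3 : 1 + Real.exp (-t) ≠ 0 := by positivity
  have h4 : 1 - Real.exp (-t) ^ 2 ≠ 0 := by
    rw [show 1 - Real.exp (-t) ^ 2 = (1 - Real.exp (-t)) * (1 + Real.exp (-t)) by ring]
    exact mul_ne_zero h2 h3
  field_simp
  ring

theorem coth_eq {t : ℝ} (ht : 0 < t) :
    (1 + Real.exp (-2 * t)) / (1 - Real.exp (-2 * t)) = heatScale t ^ 2 + 2 * heatFactor t := by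
  have h1 : Real.exp (-t) < 1 := Real.exp_lt_one_iff.2 (by linarith)
  rw [heatScale_sq ht, heatFactor, exp_neg_two_mul]
  have h2 : 1 - Real.exp (-t) ≠ 0 := by linarith
  have h3 : 1 + Real.exp (-t) ≠ 0 := by positivity
  have h4 : 1 - Real.exp (-t) ^ 2 ≠ 0 := by
    rw [show 1 - Real.exp (-t) ^ 2 = (1 - Real.exp (-t)) * (1 + Real.exp (-t)) by ring]
    exact mul_ne_zero h2 h3
  field_simp
  ring

theorem laguerreKernel1_eq (a : ℝ) {t x y : ℝ} (ht : 0 < t) (hx : 0 < x) (hy : 0 < y) :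
    laguerreKernel1 a t x y = 2 ^ (1 / 2 - a) * heatFactor t ^ (a + 1 / 2) *
      besselSeries (a + 1 / 2) (heatFactor t * (x * y)) *
      Real.exp (-(1 / 4) * (heatScale t ^ 2 + 2 * heatFactor t) * (x ^ 2 + y ^ 2)) := by
  have hw := heatFactor_pos ht
  have hxy : 0 < x * y := mul_pos hx hy
  have e1 : Real.exp (-t) * (x * y) / (1 - Real.exp (-2 * t)) = heatFactor t * (x * y) := by
    rw [heatFactor]; ring
  rw [laguerreKernel1, coth_eq ht, e1, besselI_eq_rpow_mul_besselSeries _ (by positivity),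
    show a - 1 / 2 + 1 = a + 1 / 2 by ring, ← mul_assoc (_ * _) ((_ : ℝ) ^ (a - 1 / 2))]
  congr 2
  change heatFactor t * (x * y) ^ (-a + 1 / 2) * (heatFactor t * (x * y) / 2) ^ (a - 1 / 2) = _
  rw [Real.div_rpow (by positivity) (by norm_num), Real.mul_rpow hw.le hxy.le,
    show a + 1 / 2 = 1 + (a - 1 / 2) by ring, Real.rpow_add hw, Real.rpow_one,
    show (1 / 2 - a) = -(a - 1 / 2) by ring, show -a + 1 / 2 = -(a - 1 / 2) by ring,
    Real.rpow_neg hxy.le, Real.rpow_neg (by norm_num : (0 : ℝ) ≤ 2)]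
  have := (Real.rpow_pos_of_pos hxy (a - 1 / 2)).ne'
  field_simp

theorem laguerreKernel1_nonneg {a : ℝ} (ha : -(1 / 2 : ℝ) < a) {t x y : ℝ} (ht : 0 < t)
    (hx : 0 < x) (hy : 0 < y) : 0 ≤ laguerreKernel1 a t x y := by
  rw [laguerreKernel1_eq a ht hx hy]
  have hw := heatFactor_pos ht
  have := besselSeries_nonneg (s := a + 1 / 2) (by linarith)
    (show 0 ≤ heatFactor t * (x * y) by positivity)
  positivity

theorem continuousOn_laguerreKernel1 {a : ℝ} (ha : -(1 / 2 : ℝ) < a) {t : ℝ} (ht : 0 < t) :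
    ContinuousOn (fun z : ℝ × ℝ => laguerreKernel1 a t z.1 z.2) (Ioi 0 ×ˢ Ioi 0) := by
  have hc := continuous_besselSeries (s := a + 1 / 2) (by linarith)
  have h : Continuous fun z : ℝ × ℝ => 2 ^ (1 / 2 - a) * heatFactor t ^ (a + 1 / 2) *
      besselSeries (a + 1 / 2) (heatFactor t * (z.1 * z.2)) *
      Real.exp (-(1 / 4) * (heatScale t ^ 2 + 2 * heatFactor t) * (z.1 ^ 2 + z.2 ^ 2)) := by
    fun_prop
  exact h.continuousOn.congr fun z hz => laguerreKernel1_eq a ht hz.1 hz.2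

/-- The function r ↦ r^{-1/2} (r + ξ)^{-a} is decreasing. For a < 0 the second factor increases, but
more slowly than the first decreases, exactly because a > -1/2. -/
theorem rpow_mul_rpow_le_of_le {a u v ξ : ℝ} (ha : -(1 / 2 : ℝ) < a) (hu : 0 < u) (huv : u ≤ v)
    (hξ : 0 < ξ) :
    v ^ (-(1 / 2) : ℝ) * (v + ξ) ^ (-a) ≤ u ^ (-(1 / 2) : ℝ) * (u + ξ) ^ (-a) := by
  have hv : 0 < v := hu.trans_le huv
  rcases le_total 0 a with h | h
  · exact mul_le_mul (Real.rpow_le_rpow_of_nonpos hu huv (by norm_num))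
      (Real.rpow_le_rpow_of_nonpos (by positivity) (by linarith) (by linarith))
      (by positivity) (by positivity)
  · have key : ∀ r : ℝ, 0 < r → r ^ (-(1 / 2) : ℝ) * (r + ξ) ^ (-a) =
        r ^ (-(a + 1 / 2)) * (1 + ξ / r) ^ (-a) := by
      intro r hr
      rw [show r + ξ = r * (1 + ξ / r) by field_simp, Real.mul_rpow hr.le (by positivity),
        ← mul_assoc, ← Real.rpow_add hr]
      ring_nf
    rw [key v hv, key u hu]
    refine mul_le_mul (Real.rpow_le_rpow_of_nonpos hu huv (by linarith))
      (Real.rpow_le_rpow (by positivity) ?_ (by linarith)) (by positivity) (by positivity)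
    gcongr

/-- With u = 1/w, where w is the heat factor, the left side is u^{-1/2}(u + ξ)^{-a}. Since 4w ≤
1/ρ², u is at least ρ² and monotonicity applies. For large t this matters: u is unbounded while ρ
stays below 1. -/
theorem heatFactor_rpow_mul_le {a t ξ : ℝ} (ha : -(1 / 2 : ℝ) < a) (ht : 0 < t) (hξ : 0 < ξ) :
    heatFactor t ^ (a + 1 / 2) * (1 + heatFactor t * ξ) ^ (-a) ≤
      (heatScale t)⁻¹ * (heatScale t ^ 2 + ξ) ^ (-a) := by
  have hw := heatFactor_pos ht
  have hρ := heatScale_pos ht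
  have h4 := four_mul_heatFactor ht
  have hle : heatScale t ^ 2 ≤ 1 / heatFactor t := by
    rw [le_div_iff₀ hw, ← le_div_iff₀' (by positivity)]
    have : 0 < heatScale t ^ 2 := by positivity
    linarith
  have h := rpow_mul_rpow_le_of_le ha (by positivity : 0 < heatScale t ^ 2) hle hξ
  have e1 : (heatScale t ^ 2) ^ (-(1 / 2) : ℝ) = (heatScale t)⁻¹ := by
    rw [Real.rpow_neg (by positivity), ← Real.sqrt_eq_rpow, Real.sqrt_sq hρ.le]
  rw [e1] at h
  refine le_trans (le_of_eq ?_) h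
  rw [one_div (heatFactor t), Real.inv_rpow hw.le, ← Real.rpow_neg hw.le, neg_neg,
    show (heatFactor t)⁻¹ + ξ = (heatFactor t)⁻¹ * (1 + heatFactor t * ξ) by field_simp,
    Real.mul_rpow (by positivity) (by positivity), Real.inv_rpow hw.le, ← Real.rpow_neg hw.le,
    neg_neg, ← mul_assoc, ← Real.rpow_add hw]
  ring_nf

/-- Off the diagonal 1 + XY and (X + 1)² may differ, but only by a polynomial in |X - Y|, which the
Gaussian absorbs. -/
theorem one_add_sq_le {X Y : ℝ} (hX : 0 < X) (hY : 0 < Y) :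
    1 + X * Y ≤ (X + 1) ^ 2 * (1 + |X - Y|) ^ 2 ∧
      (X + 1) ^ 2 ≤ 2 * (1 + X * Y) * (1 + |X - Y|) ^ 2 := by
  have hXY : 0 < X * Y := mul_pos hX hY
  rcases le_total X Y with h | h
  · rw [abs_of_nonpos (by linarith)]
    obtain ⟨d, hd, rfl⟩ : ∃ d, 0 ≤ d ∧ Y = X + d := ⟨Y - X, by linarith, by ring⟩
    rw [show 1 + -(X - (X + d)) = 1 + d by ring]
    have h1 : (X + 1) ^ 2 ≤ 2 * (1 + X * (X + d)) := by nlinarith [sq_nonneg (X - 1), mul_nonneg hX.le hd]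
    have h2 : 1 ≤ (1 + d) ^ 2 := by nlinarith
    constructor
    · have h3 : 1 + X * (X + d) ≤ (X + 1) ^ 2 * (1 + d) := by nlinarith [mul_nonneg hX.le hd, mul_nonneg (mul_nonneg hX.le hX.le) hd]
      have h4 : 1 + d ≤ (1 + d) ^ 2 := by nlinarith
      exact h3.trans (mul_le_mul_of_nonneg_left h4 (by positivity))
    · exact h1.trans (le_mul_of_one_le_right (by positivity) h2)
  · rw [abs_of_nonneg (by linarith)]
    obtain ⟨d, hd, rfl⟩ : ∃ d, 0 ≤ d ∧ X = Y + d := ⟨X - Y, by linarith, by ring⟩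
    rw [show 1 + (Y + d - Y) = 1 + d by ring]
    have h2 : 1 ≤ (1 + d) ^ 2 := by nlinarith
    constructor
    · have h3 : 1 + (Y + d) * Y ≤ (Y + d + 1) ^ 2 := by nlinarith [mul_nonneg hY.le hd]
      exact h3.trans (le_mul_of_one_le_right (by positivity) h2)
    · have h1 : (Y + 1) ^ 2 ≤ 2 * (1 + (Y + d) * Y) := by nlinarith [sq_nonneg (Y - 1), mul_nonneg hY.le hd]
      have h3 : Y + d + 1 ≤ (Y + 1) * (1 + d) := by nlinarith [mul_nonneg hY.le hd]
      calc (Y + d + 1) ^ 2 ≤ ((Y + 1) * (1 + d)) ^ 2 := by gcongr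
        _ = (Y + 1) ^ 2 * (1 + d) ^ 2 := by ring
        _ ≤ _ := by gcongr

theorem rpow_neg_le_of_comparable {A B c a : ℝ} (hA : 0 < A) (hB : 0 < B) (hc : 1 ≤ c)
    (h1 : A ≤ B * c) (h2 : B ≤ A * c) : A ^ (-a) ≤ B ^ (-a) * c ^ |a| := by
  have hc0 : 0 < c := by linarith
  rcases le_total 0 a with h | h
  · rw [abs_of_nonneg h, Real.rpow_neg hA.le, Real.rpow_neg hB.le, ← div_eq_inv_mul,
      ← Real.div_rpow hc0.le hB.le, ← Real.inv_rpow hA.le]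
    refine Real.rpow_le_rpow (by positivity) ?_ h
    rw [inv_le_iff_one_le_mul₀ hA, div_mul_eq_mul_div, le_div_iff₀ hB]
    linarith
  · rw [abs_of_nonpos h, ← Real.mul_rpow hB.le hc0.le]
    exact Real.rpow_le_rpow hA.le h1 (by linarith)

theorem sq_add_mul_rpow_neg_le {ρ x y : ℝ} (a : ℝ) (hρ : 0 < ρ) (hx : 0 < x) (hy : 0 < y) :
    (ρ ^ 2 + x * y) ^ (-a) ≤
      ((x + ρ) ^ (2 * a))⁻¹ * (2 * (1 + |x - y| / ρ) ^ 2) ^ |a| := by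
  have h := one_add_sq_le (div_pos hx hρ) (div_pos hy hρ)
  rw [← sub_div, abs_div, abs_of_pos hρ] at h
  have e : ((x + ρ) ^ (2 * a))⁻¹ = ((x + ρ) ^ 2) ^ (-a) := by
    rw [Real.rpow_neg (by positivity), ← Real.rpow_natCast (x + ρ) 2, ← Real.rpow_mul (by positivity)]
    norm_num
  have hd : 0 ≤ |x - y| / ρ := by positivity
  have e1 : ρ ^ 2 + x * y = ρ ^ 2 * (1 + x / ρ * (y / ρ)) := by field_simp
  have e2 : (x + ρ) ^ 2 = ρ ^ 2 * (x / ρ + 1) ^ 2 := by field_simp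
  rw [e]
  refine rpow_neg_le_of_comparable (by positivity) (by positivity) (by nlinarith) ?_ ?_
  · rw [e1, e2]
    have : 0 < ρ ^ 2 * ((x / ρ + 1) ^ 2 * (1 + |x - y| / ρ) ^ 2) := by positivity
    nlinarith [mul_le_mul_of_nonneg_left h.1 (sq_nonneg ρ)]
  · rw [e1, e2]
    nlinarith [mul_le_mul_of_nonneg_left h.2 (sq_nonneg ρ)]

theorem exp_neg_sq_div_eight_le {d : ℝ} (hd : 0 ≤ d) (M : ℕ) :
    Real.exp (-(d ^ 2 / 8)) ≤ Real.exp 3 * M.factorial / (1 + d) ^ M := by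
  have h1 := Real.pow_div_factorial_le_exp (1 + d) (by linarith) M
  have h2 : Real.exp (-(d ^ 2 / 8)) ≤ Real.exp 3 * Real.exp (-(1 + d)) := by
    rw [← Real.exp_add, Real.exp_le_exp]
    -- The inequality is d²/8 - d + 2 = (d - 4)²/8 ≥ 0.
    nlinarith [sq_nonneg (d - 4)]
  refine h2.trans ?_
  rw [mul_div_assoc, Real.exp_neg]
  gcongr
  rw [inv_le_comm₀ (Real.exp_pos _) (by positivity), inv_div]
  exact h1

theorem exists_laguerreKernel1_le {a : ℝ} (ha : -(1 / 2 : ℝ) < a) (N : ℕ) :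
    ∃ C : ℝ, 0 < C ∧ ∀ t x y : ℝ, 0 < t → 0 < x → 0 < y →
      laguerreKernel1 a t x y ≤
        C / (heatScale t * (x + heatScale t) ^ (2 * a)) / (1 + |x - y| / heatScale t) ^ N := by
  obtain ⟨C₁, hC₁, h₁⟩ := exists_besselSeries_le (s := a + 1 / 2) (by linarith)
  obtain ⟨m, hm⟩ := exists_nat_ge |a|
  -- The Gaussian is spent on 2m + N powers of 1 + d: the first 2m pay for replacing ρ² + xy by (x +
  -- ρ)², and N remain.
  refine ⟨2 ^ (1 / 2 - a) * C₁ * 2 ^ |a| * (Real.exp 3 * (2 * m + N).factorial), by positivity,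
    fun t x y ht hx hy => ?_⟩
  have hw := heatFactor_pos ht
  have hρ := heatScale_pos ht
  set w := heatFactor t with hwdef
  set ρ := heatScale t with hρdef
  have hd : 0 ≤ |x - y| / ρ := by positivity
  set d := |x - y| / ρ with hddef
  have hxy : 0 < x * y := mul_pos hx hy
  -- The left exponent is -(w/2)(x - y)² - (ρ²/4)(x² + y²). As 1/ρ² = 4w + ρ², it equals -d²/8 -
  -- (ρ²/8)(x + y)².
  have hexp : Real.exp (w * (x * y)) * Real.exp (-(1 / 4) * (ρ ^ 2 + 2 * w) * (x ^ 2 + y ^ 2)) ≤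
      Real.exp (-(d ^ 2 / 8)) := by
    rw [← Real.exp_add, Real.exp_le_exp, hddef, div_pow, sq_abs]
    have h4 : 4 * w = 1 / ρ ^ 2 - ρ ^ 2 := four_mul_heatFactor ht
    rw [show (x - y) ^ 2 / ρ ^ 2 = (x - y) ^ 2 * (4 * w + ρ ^ 2) by rw [h4]; ring]
    nlinarith [mul_nonneg (sq_nonneg ρ) (sq_nonneg (x + y))]
  have hpoly := heatFactor_rpow_mul_le ha ht hxy
  have hcomp := sq_add_mul_rpow_neg_le a hρ hx hy
  have hgauss := exp_neg_sq_div_eight_le hd (2 * m + N)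
  have hpow : (2 * (1 + d) ^ 2) ^ |a| ≤ 2 ^ |a| * (1 + d) ^ (2 * m) := by
    rw [Real.mul_rpow (by norm_num) (by positivity), pow_mul]
    gcongr
    rw [← Real.rpow_natCast _ m]
    exact Real.rpow_le_rpow_of_exponent_le (by nlinarith) hm
  rw [laguerreKernel1_eq a ht hx hy]
  have h₂ := h₁ (w * (x * y)) (by positivity)
  rw [show 1 / 2 - (a + 1 / 2) = -a by ring] at h₂
  calc 2 ^ (1 / 2 - a) * w ^ (a + 1 / 2) * besselSeries (a + 1 / 2) (w * (x * y)) *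
        Real.exp (-(1 / 4) * (ρ ^ 2 + 2 * w) * (x ^ 2 + y ^ 2))
      ≤ 2 ^ (1 / 2 - a) * w ^ (a + 1 / 2) *
        (C₁ * (1 + w * (x * y)) ^ (-a) * Real.exp (w * (x * y))) *
        Real.exp (-(1 / 4) * (ρ ^ 2 + 2 * w) * (x ^ 2 + y ^ 2)) := by gcongr
    _ = 2 ^ (1 / 2 - a) * C₁ * (w ^ (a + 1 / 2) * (1 + w * (x * y)) ^ (-a)) *
        (Real.exp (w * (x * y)) *
        Real.exp (-(1 / 4) * (ρ ^ 2 + 2 * w) * (x ^ 2 + y ^ 2))) := by ring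
    _ ≤ 2 ^ (1 / 2 - a) * C₁ * (ρ⁻¹ * (((x + ρ) ^ (2 * a))⁻¹ * (2 ^ |a| * (1 + d) ^ (2 * m)))) *
        (Real.exp 3 * (2 * m + N).factorial / (1 + d) ^ (2 * m + N)) := by
        refine mul_le_mul (mul_le_mul_of_nonneg_left (hpoly.trans ?_) (by positivity))
          (hexp.trans hgauss) (by positivity) (by positivity)
        refine mul_le_mul_of_nonneg_left (hcomp.trans ?_) (by positivity)
        exact mul_le_mul_of_nonneg_left hpow (by positivity)
    _ = _ := by
        rw [pow_add]
        field_simp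

/-! ### Covering argument for totally ordered boxes -/

/-- The open box with centre `x` and half side lengths `R`. -/
def openBox {ι : Type*} (x R : ι → ℝ) : Set (ι → ℝ) :=
  Set.pi univ fun j => Ioo (x j - R j) (x j + R j)

theorem mem_openBox {ι : Type*} {x R y : ι → ℝ} : y ∈ openBox x R ↔ ∀ j, |x j - y j| < R j := by
  simp only [openBox, Set.mem_pi, mem_univ, true_imp_iff, mem_Ioo, abs_lt]
  exact forall_congr' fun j => ⟨fun h => ⟨by linarith, by linarith⟩, fun h => ⟨by linarith, by linarith⟩⟩

theorem isOpen_openBox {ι : Type*} [Finite ι] (x R : ι → ℝ) : IsOpen (openBox x R) :=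
  isOpen_set_pi finite_univ fun _ _ => isOpen_Ioo

theorem self_mem_openBox {ι : Type*} {x R : ι → ℝ} (hR : ∀ j, 0 < R j) : x ∈ openBox x R :=
  mem_openBox.2 fun j => by simpa using hR j

/-- **Weak type (1,1)** for the averages over a totally ordered family of boxes, with respect to a
doubling measure. -/
theorem mul_measure_exists_average_gt_le {ι T : Type*} [Fintype ι] (μ : Measure (ι → ℝ))
    {U : Set (ι → ℝ)} {D : ℝ≥0∞}
    (hD : ∀ x ∈ U, ∀ R : ι → ℝ, (∀ j, 0 < R j) →
      μ (openBox x fun j => 4 * R j) ≤ D * μ (openBox x R))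
    (R : T → ι → ℝ) (hpos : ∀ t j, 0 < R t j) (htot : ∀ s t, R s ≤ R t ∨ R t ≤ R s)
    {M : ℝ} (hM : ∀ t j, R t j ≤ M) (f : (ι → ℝ) → ℝ≥0∞) (α : ℝ≥0∞) :
    α * μ {x ∈ U | ∃ t, α * μ (openBox x (R t)) < ∫⁻ y in openBox x (R t), f y ∂μ} ≤
      D * ∫⁻ y, f y ∂μ := by
  classical
  set F : Set ((ι → ℝ) × T) := {p | p.1 ∈ U ∧
    α * μ (openBox p.1 (R p.2)) < ∫⁻ y in openBox p.1 (R p.2), f y ∂μ} with hF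
  -- Vitali's lemma needs a scalar size; the product of the half sides is used. It controls each
  -- side separately only because the shapes are totally ordered.
  obtain ⟨u, huF, hdisj, hcov⟩ := Vitali.exists_disjoint_subfamily_covering_enlargement
    (fun p : (ι → ℝ) × T => openBox p.1 (R p.2)) F (fun p => ∏ j, R p.2 j) 2 one_lt_two
    (fun p _ => Finset.prod_nonneg fun j _ => (hpos _ _).le) (∏ _j : ι, M)
    (fun p _ => Finset.prod_le_prod (fun j _ => (hpos _ _).le) fun j _ => hM _ _)
    (fun p _ => ⟨p.1, self_mem_openBox (hpos _)⟩)
  have hcount : u.Countable := hdisj.countable_of_isOpen (fun p _ => isOpen_openBox _ _)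
    fun p _ => ⟨p.1, self_mem_openBox (hpos _)⟩
  have hsub : {x ∈ U | ∃ t, α * μ (openBox x (R t)) < ∫⁻ y in openBox x (R t), f y ∂μ} ⊆
      ⋃ p ∈ u, openBox p.1 fun j => 4 * R p.2 j := by
    rintro x ⟨hx, t, ht⟩
    obtain ⟨p, hp, ⟨z, hz1, hz2⟩, hδ⟩ := hcov (x, t) ⟨hx, ht⟩
    refine mem_iUnion₂.2 ⟨p, hp, mem_openBox.2 fun j => ?_⟩
    have hR : R t j ≤ 2 * R p.2 j := by
      rcases htot t p.2 with h | h
      · linarith [h j, hpos p.2 j]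
      · by_contra! hlt
        -- If every side of `R t` is at least that of `R p.2` and side j is more than twice as long,
        -- the products differ by more than the factor 2 allowed by the selection.
        have hj : ∏ i, R p.2 i * (if i = j then 2 else 1) < ∏ i, R t i := by
          refine Finset.prod_lt_prod (fun i _ => ?_) (fun i _ => ?_) ⟨j, Finset.mem_univ _, ?_⟩
          · have := hpos p.2 i
            split_ifs <;> positivity
          · split_ifs with hi
            · subst hi; linarith
            · simpa using h i
          · rw [if_pos rfl]; linarith
        rw [Finset.prod_mul_distrib, Finset.prod_ite_eq' Finset.univ j (fun _ => (2 : ℝ)),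
          if_pos (Finset.mem_univ _)] at hj
        simp only at hδ
        linarith
    have h1 := mem_openBox.1 hz1 j
    -- Only the centre x has to be covered: its distance to the selected centre is below R_t + R_p ≤
    -- 3 R_p in each coordinate, so dilation by 4 suffices.
    have h2 := mem_openBox.1 hz2 j
    simp only at h1 h2
    rw [abs_lt] at *
    constructor <;> linarith [hpos p.2 j]
  calc α * μ {x ∈ U | ∃ t, α * μ (openBox x (R t)) < ∫⁻ y in openBox x (R t), f y ∂μ}
      ≤ α * ∑' p : u, μ (openBox p.1.1 fun j => 4 * R p.1.2 j) := by
        gcongr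
        exact (measure_mono hsub).trans (measure_biUnion_le μ hcount _)
    _ ≤ α * ∑' p : u, D * μ (openBox p.1.1 (R p.1.2)) := by
        gcongr with p
        exact hD _ (huF p.2).1 _ (hpos _)
    _ = D * ∑' p : u, α * μ (openBox p.1.1 (R p.1.2)) := by
        rw [ENNReal.tsum_mul_left, ENNReal.tsum_mul_left, mul_left_comm]
    _ ≤ D * ∑' p : u, ∫⁻ y in openBox p.1.1 (R p.1.2), f y ∂μ := by
        gcongr with p
        exact (huF p.2).2.le
    _ = D * ∫⁻ y in ⋃ p ∈ u, openBox p.1 (R p.2), f y ∂μ := by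
        rw [lintegral_biUnion hcount (fun p _ => (isOpen_openBox _ _).measurableSet) hdisj]
    _ ≤ D * ∫⁻ y, f y ∂μ := by
        exact mul_le_mul' le_rfl (setLIntegral_le_lintegral _ _)

/-- The superposition `∑ 4^{-k} (averages of f over the box of size 2^k R)`. -/
def dyadicAverage {ι : Type*} [Fintype ι] (μ : Measure (ι → ℝ)) (R : ι → ℝ)
    (f : (ι → ℝ) → ℝ≥0∞) (x : ι → ℝ) : ℝ≥0∞ :=
  ∑' k : ℕ, (4⁻¹ : ℝ≥0∞) ^ k * ((μ (openBox x fun j => 2 ^ k * R j))⁻¹ *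
    ∫⁻ y in openBox x (fun j => 2 ^ k * R j), f y ∂μ)

theorem tsum_two_inv_pow : ∑' k : ℕ, (2⁻¹ : ℝ≥0∞) ^ k = 2 := by
  rw [ENNReal.tsum_geometric, ENNReal.one_sub_inv_two, inv_inv]

theorem four_inv_pow_mul_two_pow (k : ℕ) : (4⁻¹ : ℝ≥0∞) ^ k * 2 ^ k = 2⁻¹ ^ k := by
  rw [← mul_pow]
  congr 1
  rw [show (4 : ℝ≥0∞) = 2 * 2 by norm_num, ENNReal.mul_inv (by simp) (by simp), mul_assoc,
    ENNReal.inv_mul_cancel (by simp) (by simp), mul_one]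

/-- The k-th average is allowed to reach the level 2^{k-1} α. Below all these levels the weighted
sum is at most (α/2) ∑ 2^{-k} = α, while the exceptional sets have measures decaying like 2^{-k} and
can be added. -/
theorem mul_measure_exists_dyadicAverage_gt_le {ι T : Type*} [Fintype ι] (μ : Measure (ι → ℝ))
    {U : Set (ι → ℝ)} {D : ℝ≥0∞}
    (hD : ∀ x ∈ U, ∀ R : ι → ℝ, (∀ j, 0 < R j) →
      μ (openBox x fun j => 4 * R j) ≤ D * μ (openBox x R))
    (h0 : ∀ x ∈ U, ∀ R : ι → ℝ, (∀ j, 0 < R j) → μ (openBox x R) ≠ 0 ∧ μ (openBox x R) ≠ ∞)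
    (R : T → ι → ℝ) (hpos : ∀ t j, 0 < R t j) (htot : ∀ s t, R s ≤ R t ∨ R t ≤ R s)
    {M : ℝ} (hM : ∀ t j, R t j ≤ M) (f : (ι → ℝ) → ℝ≥0∞) (α : ℝ≥0∞) :
    α * μ {x ∈ U | ∃ t, α < dyadicAverage μ (R t) f x} ≤ 4 * D * ∫⁻ y, f y ∂μ := by
  set E : ℕ → Set (ι → ℝ) := fun k => {x ∈ U | ∃ t, (2⁻¹ * α * 2 ^ k) *
    μ (openBox x fun j => 2 ^ k * R t j) <
      ∫⁻ y in openBox x (fun j => 2 ^ k * R t j), f y ∂μ} with hE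
  have hsub : {x ∈ U | ∃ t, α < dyadicAverage μ (R t) f x} ⊆ ⋃ k, E k := by
    rintro x ⟨hx, t, ht⟩
    by_contra hcon
    refine absurd ht (not_lt.2 ?_)
    simp only [hE, mem_iUnion, mem_ofPred_eq, not_exists, not_and, not_lt] at hcon
    calc dyadicAverage μ (R t) f x
        ≤ ∑' k : ℕ, (4⁻¹ : ℝ≥0∞) ^ k * (2⁻¹ * α * 2 ^ k) := by
          refine ENNReal.tsum_le_tsum fun k => mul_le_mul_right ?_ _
          have hb := h0 x hx (fun j => 2 ^ k * R t j) fun j => by have := hpos t j; positivity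
          calc _ ≤ (μ (openBox x fun j => 2 ^ k * R t j))⁻¹ *
                (2⁻¹ * α * 2 ^ k * μ (openBox x fun j => 2 ^ k * R t j)) := by
                gcongr
                exact hcon k hx t
            _ = _ := by rw [mul_comm, mul_assoc, ENNReal.mul_inv_cancel hb.1 hb.2, mul_one]
      _ = 2⁻¹ * α * ∑' k : ℕ, (2⁻¹ : ℝ≥0∞) ^ k := by
          rw [← ENNReal.tsum_mul_left]
          refine tsum_congr fun k => ?_
          rw [mul_left_comm, four_inv_pow_mul_two_pow]
      _ = α := by
          rw [tsum_two_inv_pow, mul_right_comm, ENNReal.inv_mul_cancel (by simp) (by simp), one_mul]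
  have hk : ∀ k, α * μ (E k) ≤ 2⁻¹ ^ k * (2 * D * ∫⁻ y, f y ∂μ) := by
    intro k
    have h := mul_measure_exists_average_gt_le μ hD (fun t j => 2 ^ k * R t j)
      (fun t j => by have := hpos t j; positivity)
      (fun s t => (htot s t).imp (fun h j => mul_le_mul_of_nonneg_left (h j) (by positivity))
        (fun h j => mul_le_mul_of_nonneg_left (h j) (by positivity)))
      (M := 2 ^ k * M) (fun t j => mul_le_mul_of_nonneg_left (hM t j) (by positivity)) f
      (2⁻¹ * α * 2 ^ k)
    have h2 : (2⁻¹ ^ k * 2 : ℝ≥0∞) * (2⁻¹ * α * 2 ^ k) = α := by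
      rw [show (2⁻¹ ^ k * 2 : ℝ≥0∞) * (2⁻¹ * α * 2 ^ k) = α * (2⁻¹ * 2) ^ k * (2⁻¹ * 2) by ring,
        ENNReal.inv_mul_cancel (by simp) (by simp)]
      simp
    calc α * μ (E k) = (2⁻¹ ^ k * 2) * ((2⁻¹ * α * 2 ^ k) * μ (E k)) := by rw [← mul_assoc, h2]
      _ ≤ (2⁻¹ ^ k * 2) * (D * ∫⁻ y, f y ∂μ) := by gcongr
      _ = _ := by ring
  calc α * μ {x ∈ U | ∃ t, α < dyadicAverage μ (R t) f x} ≤ α * ∑' k, μ (E k) := by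
        gcongr
        exact (measure_mono hsub).trans (measure_iUnion_le _)
    _ = ∑' k, α * μ (E k) := by rw [ENNReal.tsum_mul_left]
    _ ≤ ∑' k, 2⁻¹ ^ k * (2 * D * ∫⁻ y, f y ∂μ) := ENNReal.tsum_le_tsum hk
    _ = _ := by rw [ENNReal.tsum_mul_right, tsum_two_inv_pow]; ring

theorem dyadicAverage_le_of_ae_le {ι : Type*} [Fintype ι] {μ : Measure (ι → ℝ)} {R : ι → ℝ}
    {f : (ι → ℝ) → ℝ≥0∞} {x : ι → ℝ} {c : ℝ≥0∞} (hf : ∀ᵐ y ∂μ, f y ≤ c) :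
    dyadicAverage μ R f x ≤ 2 * c := by
  calc dyadicAverage μ R f x ≤ ∑' k : ℕ, (2⁻¹ : ℝ≥0∞) ^ k * c := by
        refine ENNReal.tsum_le_tsum fun k => mul_le_mul' ?_ ?_
        · gcongr
          norm_num
        · calc _ ≤ (μ (openBox x fun j => 2 ^ k * R j))⁻¹ *
                ∫⁻ y in openBox x (fun j => 2 ^ k * R j), c ∂μ := by
                gcongr 1
                exact lintegral_mono_ae (ae_restrict_of_ae hf)
            _ ≤ 1 * c := by
                rw [setLIntegral_const, mul_left_comm, mul_comm]
                gcongr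
                exact ENNReal.inv_mul_le_one _
            _ = c := one_mul c
    _ = 2 * c := by rw [ENNReal.tsum_mul_right, tsum_two_inv_pow]

theorem dyadicAverage_add_le {ι : Type*} [Fintype ι] {μ : Measure (ι → ℝ)} {R : ι → ℝ}
    {f g : (ι → ℝ) → ℝ≥0∞} (hg : AEMeasurable g μ) {x : ι → ℝ} :
    dyadicAverage μ R (fun y => f y + g y) x = dyadicAverage μ R f x + dyadicAverage μ R g x := by
  simp only [dyadicAverage]
  rw [← ENNReal.tsum_add]
  refine tsum_congr fun k => ?_
  rw [lintegral_add_right' _ hg.restrict]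
  ring

/-! ### Measure of intervals and boxes, doubling -/

/-- The size, up to constants, of the interval `(x - R, x + R)` for the measure `x^{2a} dx`. -/
def intervalSize (a x R : ℝ) : ℝ := R * (x + R) ^ (2 * a)

theorem intervalSize_pos {a x R : ℝ} (hx : 0 < x) (hR : 0 < R) : 0 < intervalSize a x R := by
  unfold intervalSize
  positivity

theorem intervalSize_mul_le {a x R l : ℝ} (hx : 0 < x) (hR : 0 < R) (hl : 1 ≤ l) {m : ℕ}
    (hm : 1 + 2 * |a| ≤ m) : intervalSize a x (l * R) ≤ l ^ m * intervalSize a x R := by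
  have hl0 : 0 < l := by linarith
  have h1 : (x + l * R) ^ (2 * a) ≤ l ^ (2 * |a|) * (x + R) ^ (2 * a) := by
    rcases le_total 0 a with h | h
    · rw [abs_of_nonneg h, ← Real.mul_rpow hl0.le (by positivity)]
      exact Real.rpow_le_rpow (by positivity) (by nlinarith) (by linarith)
    · calc (x + l * R) ^ (2 * a) ≤ (x + R) ^ (2 * a) :=
            Real.rpow_le_rpow_of_nonpos (by positivity) (by nlinarith) (by linarith)
        _ ≤ _ := le_mul_of_one_le_left (by positivity) (Real.one_le_rpow hl (by positivity))
  have h2 : l * l ^ (2 * |a|) ≤ l ^ m := by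
    rw [← Real.rpow_natCast l m, ← Real.rpow_one_add' hl0.le (by positivity)]
    exact Real.rpow_le_rpow_of_exponent_le hl hm
  unfold intervalSize
  calc l * R * (x + l * R) ^ (2 * a) ≤ l * R * (l ^ (2 * |a|) * (x + R) ^ (2 * a)) := by gcongr
    _ = (l * l ^ (2 * |a|)) * (R * (x + R) ^ (2 * a)) := by ring
    _ ≤ _ := by gcongr

theorem rpow_le_of_div_le {a y L l : ℝ} (hL : 0 < L) (hl : 1 ≤ l) (h1 : L / l ≤ y) (h2 : y ≤ L) :
    y ^ (2 * a) ≤ l ^ (2 * |a|) * L ^ (2 * a) ∧ L ^ (2 * a) ≤ l ^ (2 * |a|) * y ^ (2 * a) := by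
  have hl0 : 0 < l := by linarith
  have hy : 0 < y := lt_of_lt_of_le (by positivity) h1
  have h3 : L ≤ l * y := by rwa [div_le_iff₀' hl0] at h1
  have h4 : 1 ≤ l ^ (2 * |a|) := Real.one_le_rpow hl (by positivity)
  rcases le_total 0 a with h | h
  · constructor
    · exact (Real.rpow_le_rpow hy.le h2 (by linarith)).trans
        (le_mul_of_one_le_left (by positivity) h4)
    · rw [abs_of_nonneg h, ← Real.mul_rpow hl0.le hy.le]
      exact Real.rpow_le_rpow hL.le h3 (by linarith)
  · constructor
    · have := Real.rpow_le_rpow_of_nonpos hL h3 (by linarith : 2 * a ≤ 0)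
      rw [Real.mul_rpow hl0.le hy.le] at this
      rw [abs_of_nonpos h, show 2 * -a = -(2 * a) by ring, Real.rpow_neg hl0.le, ← div_eq_inv_mul,
        le_div_iff₀' (by positivity)]
      exact this
    · exact (Real.rpow_le_rpow_of_nonpos hy h2 (by linarith)).trans
        (le_mul_of_one_le_left (by positivity) h4)

theorem powerMeasure_apply (a : ℝ) {s : Set ℝ} (hs : MeasurableSet s) :
    powerMeasure a s = ∫⁻ y in s ∩ Ioi 0, ENNReal.ofReal (y ^ (2 * a)) := by
  rw [powerMeasure, withDensity_apply _ hs, Measure.restrict_restrict hs]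

theorem lintegral_rpow_Ioo {b L : ℝ} (hb : -1 < b) (hL : 0 < L) :
    ∫⁻ y in Ioo 0 L, ENNReal.ofReal (y ^ b) = ENNReal.ofReal (L ^ (b + 1) / (b + 1)) := by
  have h1 := (intervalIntegral.intervalIntegrable_rpow' (a := 0) (b := L) hb)
  rw [intervalIntegrable_iff_integrableOn_Ioo_of_le hL.le] at h1
  rw [← ofReal_integral_eq_lintegral_ofReal h1]
  · rw [← integral_Ioc_eq_integral_Ioo, ← intervalIntegral.integral_of_le hL.le,
      integral_rpow (Or.inl hb), Real.zero_rpow (by linarith), sub_zero]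
  · exact (ae_restrict_iff' measurableSet_Ioo).2 (ae_of_all _ fun y hy => Real.rpow_nonneg hy.1.le _)

theorem exists_powerMeasure_Ioo_le {a : ℝ} (ha : -(1 / 2 : ℝ) < a) :
    ∃ C : ℝ, 0 < C ∧ ∀ x R : ℝ, 0 < x → 0 < R →
      powerMeasure a (Ioo (x - R) (x + R)) ≤ ENNReal.ofReal (C * intervalSize a x R) := by
  have ha' : 0 < 2 * a + 1 := by linarith
  refine ⟨2 * 3 ^ (2 * |a|) + 3 / (2 * a + 1), by positivity, fun x R hx hR => ?_⟩
  rw [powerMeasure_apply a measurableSet_Ioo]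
  have hL : 0 < x + R := by positivity
  have hLp : 0 < (x + R) ^ (2 * a) := by positivity
  -- For R ≤ x/2 every y in the interval is at least (x + R)/3, so the density is comparable to (x +
  -- R)^{2a}. Otherwise x + R ≤ 3R and the integral over all of (0, x + R) is affordable; a > -1/2
  -- makes it finite.
  rcases le_total R (x / 2) with h | h
  · calc ∫⁻ y in Ioo (x - R) (x + R) ∩ Ioi 0, ENNReal.ofReal (y ^ (2 * a))
        ≤ ∫⁻ y in Ioo (x - R) (x + R), ENNReal.ofReal (y ^ (2 * a)) :=
          lintegral_mono_set inter_subset_left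
      _ ≤ ∫⁻ y in Ioo (x - R) (x + R), ENNReal.ofReal (3 ^ (2 * |a|) * (x + R) ^ (2 * a)) := by
          refine setLIntegral_mono measurable_const fun y hy => ENNReal.ofReal_le_ofReal ?_
          exact (rpow_le_of_div_le hL (by norm_num) (by linarith [hy.1]) hy.2.le).1
      _ = ENNReal.ofReal (3 ^ (2 * |a|) * (x + R) ^ (2 * a) * (2 * R)) := by
          rw [setLIntegral_const, Real.volume_Ioo, ← ENNReal.ofReal_mul (by positivity)]
          ring_nf
      _ ≤ _ := by
          refine ENNReal.ofReal_le_ofReal ?_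
          unfold intervalSize
          have : 0 ≤ 3 / (2 * a + 1) * (R * (x + R) ^ (2 * a)) := by positivity
          linarith
  · calc ∫⁻ y in Ioo (x - R) (x + R) ∩ Ioi 0, ENNReal.ofReal (y ^ (2 * a))
        ≤ ∫⁻ y in Ioo 0 (x + R), ENNReal.ofReal (y ^ (2 * a)) :=
          lintegral_mono_set fun y hy => ⟨hy.2, hy.1.2⟩
      _ = ENNReal.ofReal ((x + R) ^ (2 * a + 1) / (2 * a + 1)) :=
          lintegral_rpow_Ioo (by linarith) hL
      _ ≤ _ := by
          refine ENNReal.ofReal_le_ofReal ?_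
          unfold intervalSize
          rw [Real.rpow_add_one hL.ne', add_mul]
          have h1 : (x + R) ^ (2 * a) * (x + R) / (2 * a + 1) ≤
              3 / (2 * a + 1) * (R * (x + R) ^ (2 * a)) := by
            rw [div_mul_eq_mul_div]
            refine div_le_div_of_nonneg_right ?_ ha'.le
            nlinarith
          have : 0 ≤ 2 * 3 ^ (2 * |a|) * (R * (x + R) ^ (2 * a)) := by positivity
          linarith

theorem exists_le_powerMeasure_Ioo (a : ℝ) :
    ∃ c : ℝ, 0 < c ∧ ∀ x R : ℝ, 0 < x → 0 < R →
      ENNReal.ofReal (c * intervalSize a x R) ≤ powerMeasure a (Ioo (x - R) (x + R)) := by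
  refine ⟨(2 * 2 ^ (2 * |a|))⁻¹, by positivity, fun x R hx hR => ?_⟩
  rw [powerMeasure_apply a measurableSet_Ioo]
  have hL : 0 < x + R := by positivity
  -- The right quarter of the interval is enough: it avoids 0, and there y ≥ (x + R)/2.
  calc ENNReal.ofReal ((2 * 2 ^ (2 * |a|))⁻¹ * intervalSize a x R)
      = ENNReal.ofReal ((2 ^ (2 * |a|))⁻¹ * (x + R) ^ (2 * a)) * volume (Ioo (x + R / 2) (x + R)) := by
        rw [Real.volume_Ioo, ← ENNReal.ofReal_mul (by positivity), intervalSize]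
        congr 1
        field_simp
        ring
    _ = ∫⁻ y in Ioo (x + R / 2) (x + R), ENNReal.ofReal ((2 ^ (2 * |a|))⁻¹ * (x + R) ^ (2 * a)) := by
        rw [setLIntegral_const]
    _ ≤ ∫⁻ y in Ioo (x + R / 2) (x + R), ENNReal.ofReal (y ^ (2 * a)) := by
        refine setLIntegral_mono' measurableSet_Ioo fun y hy => ENNReal.ofReal_le_ofReal ?_
        rw [inv_mul_le_iff₀ (by positivity)]
        exact (rpow_le_of_div_le hL (by norm_num) (by linarith [hy.1]) hy.2.le).2
    _ ≤ _ := by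
        refine lintegral_mono_set fun y hy => ⟨⟨?_, hy.2⟩, mem_Ioi.2 ?_⟩ <;> linarith [hy.1]

/-- The size, up to constants, of `openBox x R` for the Laguerre measure. -/
def boxSize {n : ℕ} (lam x R : Fin n → ℝ) : ℝ := ∏ j, intervalSize (lam j) (x j) (R j)

theorem boxSize_pos {n : ℕ} {lam x R : Fin n → ℝ} (hx : ∀ j, 0 < x j) (hR : ∀ j, 0 < R j) :
    0 < boxSize lam x R := Finset.prod_pos fun j _ => intervalSize_pos (hx j) (hR j)

theorem exists_boxSize_mul_le {n : ℕ} (lam : Fin n → ℝ) :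
    ∃ m : ℕ, ∀ (x R : Fin n → ℝ) (l : ℝ), (∀ j, 0 < x j) → (∀ j, 0 < R j) → 1 ≤ l →
      boxSize lam x (fun j => l * R j) ≤ l ^ m * boxSize lam x R := by
  choose m hm using fun j => exists_nat_ge (1 + 2 * |lam j|)
  refine ⟨∑ j, m j, fun x R l hx hR hl => ?_⟩
  rw [← Finset.prod_pow_eq_pow_sum, boxSize, boxSize, ← Finset.prod_mul_distrib]
  refine Finset.prod_le_prod (fun j _ => (intervalSize_pos (hx j) ?_).le) fun j _ =>
    intervalSize_mul_le (hx j) (hR j) hl (hm j)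
  have := hR j
  positivity

theorem laguerreMeasure_openBox {n : ℕ} (lam x R : Fin n → ℝ) :
    laguerreMeasure lam (openBox x R) =
      ∏ j, powerMeasure (lam j) (Ioo (x j - R j) (x j + R j)) := by
  rw [laguerreMeasure, openBox, Measure.pi_pi]

theorem exists_laguerreMeasure_openBox_bounds {n : ℕ} {lam : Fin n → ℝ}
    (hlam : ∀ j, -(1 / 2 : ℝ) < lam j) :
    ∃ c C : ℝ, 0 < c ∧ 0 < C ∧ ∀ x R : Fin n → ℝ, (∀ j, 0 < x j) → (∀ j, 0 < R j) →
      ENNReal.ofReal (c * boxSize lam x R) ≤ laguerreMeasure lam (openBox x R) ∧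
      laguerreMeasure lam (openBox x R) ≤ ENNReal.ofReal (C * boxSize lam x R) := by
  choose c hc hc' using fun j => exists_le_powerMeasure_Ioo (lam j)
  choose C hC hC' using fun j => exists_powerMeasure_Ioo_le (hlam j)
  refine ⟨∏ j, c j, ∏ j, C j, Finset.prod_pos fun j _ => hc j, Finset.prod_pos fun j _ => hC j,
    fun x R hx hR => ?_⟩
  have hv : ∀ j, 0 < intervalSize (lam j) (x j) (R j) := fun j => intervalSize_pos (hx j) (hR j)
  rw [laguerreMeasure_openBox, boxSize, ← Finset.prod_mul_distrib, ← Finset.prod_mul_distrib,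
    ENNReal.ofReal_prod_of_nonneg fun j _ => (mul_pos (hc j) (hv j)).le,
    ENNReal.ofReal_prod_of_nonneg fun j _ => (mul_pos (hC j) (hv j)).le]
  exact ⟨Finset.prod_le_prod' fun j _ => hc' j _ _ (hx j) (hR j),
    Finset.prod_le_prod' fun j _ => hC' j _ _ (hx j) (hR j)⟩

theorem laguerreMeasure_openBox_ne {n : ℕ} {lam : Fin n → ℝ} (hlam : ∀ j, -(1 / 2 : ℝ) < lam j)
    {x R : Fin n → ℝ} (hx : ∀ j, 0 < x j) (hR : ∀ j, 0 < R j) :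
    laguerreMeasure lam (openBox x R) ≠ 0 ∧ laguerreMeasure lam (openBox x R) ≠ ∞ := by
  obtain ⟨c, C, hc, hC, h⟩ := exists_laguerreMeasure_openBox_bounds hlam
  obtain ⟨h1, h2⟩ := h x R hx hR
  have hv := boxSize_pos (lam := lam) hx hR
  exact ⟨((ENNReal.ofReal_pos.2 (mul_pos hc hv)).trans_le h1).ne',
    (h2.trans_lt ENNReal.ofReal_lt_top).ne⟩

theorem exists_laguerreMeasure_doubling {n : ℕ} {lam : Fin n → ℝ}
    (hlam : ∀ j, -(1 / 2 : ℝ) < lam j) :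
    ∃ D : ℝ≥0, ∀ x R : Fin n → ℝ, (∀ j, 0 < x j) → (∀ j, 0 < R j) →
      laguerreMeasure lam (openBox x fun j => 4 * R j) ≤
        D * laguerreMeasure lam (openBox x R) := by
  obtain ⟨c, C, hc, hC, h⟩ := exists_laguerreMeasure_openBox_bounds hlam
  obtain ⟨m, hm⟩ := exists_boxSize_mul_le lam
  refine ⟨Real.toNNReal (C * 4 ^ m / c), fun x R hx hR => ?_⟩
  have hv := boxSize_pos (lam := lam) hx hR
  calc laguerreMeasure lam (openBox x fun j => 4 * R j)
      ≤ ENNReal.ofReal (C * boxSize lam x fun j => 4 * R j) :=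
        (h x _ hx fun j => by have := hR j; positivity).2
    _ ≤ ENNReal.ofReal (C * 4 ^ m / c * (c * boxSize lam x R)) := by
        refine ENNReal.ofReal_le_ofReal ?_
        have := hm x R 4 hx hR (by norm_num)
        calc C * boxSize lam x (fun j => 4 * R j) ≤ C * (4 ^ m * boxSize lam x R) := by gcongr
          _ = _ := by field_simp
    _ = ENNReal.ofReal (C * 4 ^ m / c) * ENNReal.ofReal (c * boxSize lam x R) :=
        ENNReal.ofReal_mul (by positivity)
    _ ≤ _ := mul_le_mul' le_rfl (h x R hx hR).1

/-! ### Interpolation -/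

/-- The layer cake formula for powers of an extended nonnegative function. -/
theorem lintegral_rpow_eq_lintegral_meas_ofReal_lt {X : Type*} [MeasurableSpace X] {μ : Measure X}
    {g : X → ℝ≥0∞} (hg : AEMeasurable g μ) (hfin : ∀ᵐ x ∂μ, g x < ∞) {q : ℝ} (hq : 0 < q) :
    ∫⁻ x, g x ^ q ∂μ = ENNReal.ofReal q *
      ∫⁻ t in Ioi (0 : ℝ), μ {x | ENNReal.ofReal t < g x} * ENNReal.ofReal (t ^ (q - 1)) := by
  have h := lintegral_rpow_eq_lintegral_meas_lt_mul μ (f := fun x => (g x).toReal)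
    (ae_of_all _ fun x => ENNReal.toReal_nonneg) hg.ennreal_toReal hq
  have h1 : ∫⁻ x, g x ^ q ∂μ = ∫⁻ x, ENNReal.ofReal ((g x).toReal ^ q) ∂μ := by
    refine lintegral_congr_ae ?_
    filter_upwards [hfin] with x hx
    rw [← ENNReal.ofReal_rpow_of_nonneg ENNReal.toReal_nonneg hq.le, ENNReal.ofReal_toReal hx.ne]
  rw [h1, h]
  congr 1
  refine setLIntegral_congr_fun measurableSet_Ioi fun t ht => ?_
  congr 1
  refine measure_congr ?_
  filter_upwards [hfin] with x hx
  exact propext (ENNReal.ofReal_lt_iff_lt_toReal (le_of_lt ht) hx.ne).symm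

/-- A Marcinkiewicz-type interpolation: a weak type estimate localised to the set where `h` is
large implies strong type `(q, q)`, `1 < q < ∞`. -/
theorem lintegral_rpow_le_of_localized_weak_type {X : Type*} [MeasurableSpace X] {μ : Measure X}
    {g h : X → ℝ≥0∞} (hg : AEMeasurable g μ) (hh : AEMeasurable h μ) (hfin : ∀ x, h x < ∞)
    {A C : ℝ≥0} (hA : 0 < A)
    (hweak : ∀ a : ℝ≥0, 0 < a →
      a * μ {x | (A * a : ℝ≥0∞) < g x} ≤ C * ∫⁻ x in {x | (a : ℝ≥0∞) < h x}, h x ∂μ)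
    {q : ℝ} (hq : 1 < q) (hq_fin : ∫⁻ x, h x ^ q ∂μ ≠ ∞) :
    ∫⁻ x, g x ^ q ∂μ ≤
      (A : ℝ≥0∞) ^ q * (ENNReal.ofReal q * (C * (ENNReal.ofReal (q - 1))⁻¹)) *
        ∫⁻ x, h x ^ q ∂μ := by
  have hq0 : 0 < q := by linarith
  have hq1 : 0 < q - 1 := by linarith
  have hA0 : (A : ℝ≥0∞) ≠ 0 := by exact_mod_cast hA.ne'
  have hnull : ∀ a : ℝ≥0, NullMeasurableSet {x | (a : ℝ≥0∞) < h x} μ := fun a =>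
    nullMeasurableSet_lt aemeasurable_const hh
  -- Where h > a ≥ 1 one has h ≤ h^q, so a μ{g = ∞} stays bounded as a → ∞.
  have hgfin : ∀ᵐ x ∂μ, g x < ∞ := by
    have hb : ∀ a : ℝ≥0, 1 ≤ a → a * μ {x | g x = ∞} ≤ C * ∫⁻ x, h x ^ q ∂μ := by
      intro a ha
      calc a * μ {x | g x = ∞} ≤ a * μ {x | (A * a : ℝ≥0∞) < g x} := by
            gcongr with x
            intro hx
            rw [hx]
            exact ENNReal.mul_lt_top ENNReal.coe_lt_top ENNReal.coe_lt_top
        _ ≤ C * ∫⁻ x in {x | (a : ℝ≥0∞) < h x}, h x ∂μ := hweak a (by positivity)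
        _ ≤ C * ∫⁻ x in {x | (a : ℝ≥0∞) < h x}, h x ^ q ∂μ := by
            refine mul_le_mul' le_rfl (lintegral_mono_ae ?_)
            filter_upwards [ae_restrict_mem₀ (hnull a)] with x hx
            refine ENNReal.le_rpow_self_of_one_le ?_ hq.le
            exact le_trans (by exact_mod_cast ha) (le_of_lt hx)
        _ ≤ C * ∫⁻ x, h x ^ q ∂μ := mul_le_mul' le_rfl (setLIntegral_le_lintegral _ _)
    have hz : μ {x | g x = ∞} = 0 := by
      by_contra hne
      obtain ⟨k, hk⟩ := ENNReal.exists_nat_mul_gt hne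
        (ENNReal.mul_ne_top (ENNReal.coe_ne_top (r := C)) hq_fin)
      have := hb ((k + 1 : ℕ) : ℝ≥0) (by push_cast; exact le_add_self)
      refine absurd (hk.trans_le (le_trans ?_ this)) (lt_irrefl _)
      gcongr
      push_cast
      exact le_self_add
    have : ∀ᵐ x ∂μ, g x ≠ ∞ := by
      rw [ae_iff]
      simpa using hz
    filter_upwards [this] with x hx using lt_top_iff_ne_top.2 hx
  -- For the measure h dμ, the right side of the weak estimate is the distribution function of h.
  -- Integrating against t^{q-2} produces the layer cake formula for h^{q-1} with respect to ν, that
  -- is, ∫ h^q dμ.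
  set ν := μ.withDensity h with hν
  have hac : ν ≪ μ := withDensity_absolutelyContinuous μ h
  have hg' : AEMeasurable (fun x => (A : ℝ≥0∞)⁻¹ * g x) μ := hg.const_mul _
  have hset : ∀ (x : X) (b : ℝ≥0∞), b < (A : ℝ≥0∞)⁻¹ * g x ↔ A * b < g x := by
    intro x b
    rw [mul_comm, ← div_eq_mul_inv, ENNReal.lt_div_iff_mul_lt (Or.inl hA0)
      (Or.inl ENNReal.coe_ne_top), mul_comm]
  have h1 := lintegral_rpow_eq_lintegral_meas_ofReal_lt hg'
    (by filter_upwards [hgfin] with x hx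
        exact ENNReal.mul_lt_top (ENNReal.inv_lt_top.2 (pos_iff_ne_zero.2 hA0)) hx) hq0
  have h2 := lintegral_rpow_eq_lintegral_meas_ofReal_lt (hh.mono_ac hac) (ae_of_all ν hfin) hq1
  have h3 : ∫⁻ x, h x ^ (q - 1) ∂ν = ∫⁻ x, h x ^ q ∂μ := by
    rw [lintegral_withDensity_eq_lintegral_mul₀ hh (hh.pow_const _)]
    refine lintegral_congr fun x => ?_
    change h x * h x ^ (q - 1) = _
    rcases eq_or_ne (h x) 0 with h0 | h0
    · rw [h0, zero_mul, ENNReal.zero_rpow_of_pos hq0]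
    · nth_rw 1 [← ENNReal.rpow_one (h x)]
      rw [← ENNReal.rpow_add _ _ h0 (hfin x).ne]
      ring_nf
  have h4 : ∫⁻ t in Ioi (0 : ℝ), μ {x | ENNReal.ofReal t < (A : ℝ≥0∞)⁻¹ * g x} *
      ENNReal.ofReal (t ^ (q - 1)) ≤ C * ∫⁻ t in Ioi (0 : ℝ), ν {x | ENNReal.ofReal t < h x} *
      ENNReal.ofReal (t ^ (q - 1 - 1)) := by
    rw [← lintegral_const_mul' _ _ ENNReal.coe_ne_top]
    refine setLIntegral_mono' measurableSet_Ioi fun t ht => ?_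
    have ht0 : 0 < t := ht
    simp only [hset]
    calc μ {x | A * ENNReal.ofReal t < g x} * ENNReal.ofReal (t ^ (q - 1))
        = (ENNReal.ofReal t * μ {x | A * ENNReal.ofReal t < g x}) *
          ENNReal.ofReal (t ^ (q - 1 - 1)) := by
          rw [mul_right_comm, ← ENNReal.ofReal_mul ht0.le, mul_comm]
          congr 2
          nth_rw 2 [← Real.rpow_one t]
          rw [← Real.rpow_add ht0]
          ring_nf
      _ ≤ (C * ∫⁻ x in {x | ENNReal.ofReal t < h x}, h x ∂μ) *
          ENNReal.ofReal (t ^ (q - 1 - 1)) := by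
          exact mul_le_mul' (hweak t.toNNReal (by simpa using ht0)) le_rfl
      _ = _ := by
          have hwd : ν {x | ENNReal.ofReal t < h x} = ∫⁻ x in {x | ENNReal.ofReal t < h x}, h x ∂μ :=
            withDensity_apply₀ _ (hnull t.toNNReal)
          rw [hwd, mul_assoc]
  have h5 : ∫⁻ t in Ioi (0 : ℝ), ν {x | ENNReal.ofReal t < h x} *
      ENNReal.ofReal (t ^ (q - 1 - 1)) = (ENNReal.ofReal (q - 1))⁻¹ * ∫⁻ x, h x ^ q ∂μ := by
    rw [← h3, h2, ← mul_assoc, ENNReal.inv_mul_cancel (by simpa using hq) ENNReal.ofReal_ne_top,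
      one_mul]
  have h6 : ∫⁻ x, g x ^ q ∂μ = (A : ℝ≥0∞) ^ q * ∫⁻ x, ((A : ℝ≥0∞)⁻¹ * g x) ^ q ∂μ := by
    rw [← lintegral_const_mul' _ _ (ENNReal.rpow_ne_top_of_nonneg hq0.le ENNReal.coe_ne_top)]
    refine lintegral_congr fun x => ?_
    rw [← ENNReal.mul_rpow_of_nonneg _ _ hq0.le, ← mul_assoc,
      ENNReal.mul_inv_cancel hA0 ENNReal.coe_ne_top, one_mul]
  rw [h6, h1, mul_assoc, mul_assoc]
  gcongr
  rw [mul_assoc, ← h5]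
  exact h4

/-! ### Decay profiles and domination by averages -/

/-- The open positive orthant. -/
def positiveOrthant (n : ℕ) : Set (Fin n → ℝ) := {x | ∀ j, 0 < x j}

theorem isOpen_positiveOrthant (n : ℕ) : IsOpen (positiveOrthant n) := by
  have : positiveOrthant n = Set.pi univ fun _ => Ioi (0 : ℝ) := by
    ext x
    simp [positiveOrthant]
  rw [this]
  exact isOpen_set_pi finite_univ fun _ _ => isOpen_Ioi

theorem ae_mem_positiveOrthant {n : ℕ} (lam : Fin n → ℝ) :
    ∀ᵐ x ∂laguerreMeasure lam, x ∈ positiveOrthant n := by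
  change ∀ᵐ x ∂laguerreMeasure lam, ∀ j, 0 < x j
  refine ae_all_iff.2 fun j => ?_
  have h : ∀ᵐ y ∂powerMeasure (lam j), 0 < y :=
    (withDensity_absolutelyContinuous _ _).ae_le (ae_restrict_mem measurableSet_Ioi)
  exact (Measure.quasiMeasurePreserving_eval (μ := fun j => powerMeasure (lam j)) j).ae h

/-- The polynomial decay profile `∏ (1 + |x_j - y_j| / R_j)^{-N}`. -/
def boxDecay {n : ℕ} (N : ℕ) (R x y : Fin n → ℝ) : ℝ := ∏ j, ((1 + |x j - y j| / R j) ^ N)⁻¹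

section boxDecay

variable {n : ℕ} {N : ℕ} {R x y : Fin n → ℝ}

theorem boxDecay_nonneg (hR : ∀ j, 0 < R j) : 0 ≤ boxDecay N R x y :=
  Finset.prod_nonneg fun j _ => by have := hR j; positivity

theorem boxDecay_le_one (hR : ∀ j, 0 < R j) : boxDecay N R x y ≤ 1 := by
  refine Finset.prod_le_one (fun j _ => by have := hR j; positivity) fun j _ => ?_
  have : 0 ≤ |x j - y j| / R j := by have := hR j; positivity
  exact inv_le_one_of_one_le₀ (one_le_pow₀ (by linarith))

theorem continuous_boxDecay (hR : ∀ j, 0 < R j) : Continuous fun y => boxDecay N R x y := by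
  refine continuous_finsetProd _ fun j _ => ?_
  refine Continuous.inv₀ (by fun_prop) fun y => ?_
  have := hR j
  positivity

theorem boxDecay_le_of_near (hR : ∀ j, 0 < R j) {x' : Fin n → ℝ} (h : ∀ j, |x' j - x j| ≤ R j) :
    boxDecay N R x' y ≤ (∏ _j : Fin n, (2 : ℝ) ^ N) * boxDecay N R x y := by
  rw [boxDecay, boxDecay, ← Finset.prod_mul_distrib]
  refine Finset.prod_le_prod (fun j _ => by have := hR j; positivity) fun j _ => ?_
  have hj := hR j
  rw [← div_eq_mul_inv, inv_eq_one_div, div_le_div_iff₀ (by positivity) (by positivity), one_mul,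
    ← mul_pow]
  gcongr
  have h1 : |x j - y j| ≤ R j + |x' j - y j| := by
    have := abs_sub_le (x j) (x' j) (y j)
    rw [abs_sub_comm (x j) (x' j)] at this
    linarith [h j]
  have h2 : |x j - y j| / R j ≤ 1 + |x' j - y j| / R j := by
    rw [div_le_iff₀ hj, add_mul, div_mul_cancel₀ _ hj.ne']
    linarith
  have h3 : 0 ≤ |x' j - y j| / R j := by positivity
  linarith

theorem exists_mem_openBox_boxDecay_le (N : ℕ) (hR : ∀ j, 0 < R j) (x y : Fin n → ℝ) :
    ∃ k : ℕ, y ∈ openBox x (fun j => 2 ^ k * R j) ∧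
      boxDecay N R x y ≤ 2 ^ N * ((2 ^ k) ^ N)⁻¹ := by
  classical
  have hex : ∃ k : ℕ, y ∈ openBox x (fun j => 2 ^ k * R j) := by
    obtain ⟨k, hk⟩ := pow_unbounded_of_one_lt (∑ j, |x j - y j| / R j) one_lt_two
    refine ⟨k, mem_openBox.2 fun j => ?_⟩
    rw [← div_lt_iff₀ (hR j)]
    refine lt_of_le_of_lt ?_ hk
    exact Finset.single_le_sum (f := fun j => |x j - y j| / R j)
      (fun i _ => by have := hR i; positivity) (Finset.mem_univ j)
  -- For the least such k ≥ 1, y misses the box of index k - 1, so one coordinate alone gives decay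
  -- 2^{-(k-1)N}; the factor 2^N restores the index k.
  refine ⟨Nat.find hex, Nat.find_spec hex, ?_⟩
  rcases hk : Nat.find hex with _ | k
  · calc boxDecay N R x y ≤ 1 := boxDecay_le_one hR
      _ ≤ 2 ^ N := one_le_pow₀ one_le_two
      _ = _ := by simp
  · have hnot := Nat.find_min hex (m := k) (by omega)
    rw [mem_openBox] at hnot
    push Not at hnot
    obtain ⟨j, hj⟩ := hnot
    rw [← le_div_iff₀ (hR j)] at hj
    have h1 : boxDecay N R x y ≤ ((1 + |x j - y j| / R j) ^ N)⁻¹ := by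
      rw [boxDecay, ← Finset.mul_prod_erase _ _ (Finset.mem_univ j)]
      have := hR j
      refine mul_le_of_le_one_right (by positivity)
        (Finset.prod_le_one (fun j _ => by have := hR j; positivity) fun j _ => ?_)
      have : 0 ≤ |x j - y j| / R j := by have := hR j; positivity
      exact inv_le_one_of_one_le₀ (one_le_pow₀ (by linarith))
    refine h1.trans ?_
    rw [← inv_inv ((2 : ℝ) ^ N), ← mul_inv]
    refine inv_anti₀ (by positivity) ?_
    rw [← inv_pow, ← mul_pow]
    gcongr
    rw [pow_succ]
    linarith

end boxDecay

theorem exists_lintegral_boxDecay_mul_le {n : ℕ} {lam : Fin n → ℝ}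
    (hlam : ∀ j, -(1 / 2 : ℝ) < lam j) :
    ∃ (N : ℕ) (C : ℝ), 0 < C ∧ ∀ x R : Fin n → ℝ, (∀ j, 0 < x j) → (∀ j, 0 < R j) →
      ∀ h : (Fin n → ℝ) → ℝ≥0∞, AEMeasurable h (laguerreMeasure lam) →
        ∫⁻ y, ENNReal.ofReal (boxDecay N R x y) * h y ∂laguerreMeasure lam ≤
          ENNReal.ofReal (C * boxSize lam x R) * dyadicAverage (laguerreMeasure lam) R h x := by
  obtain ⟨c, C, hc, hC, hμ⟩ := exists_laguerreMeasure_openBox_bounds hlam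
  obtain ⟨m, hm⟩ := exists_boxSize_mul_le lam
  -- Dilation by 2^k costs at most (2^k)^m in measure, so the exponent m + 2 leaves exactly the
  -- weight 4^{-k}.
  refine ⟨m + 2, 2 ^ (m + 2) * C, by positivity, fun x R hx hR h hh => ?_⟩
  set μ := laguerreMeasure lam with hμdef
  set B : ℕ → Set (Fin n → ℝ) := fun k => openBox x fun j => 2 ^ k * R j with hB
  have hBm : ∀ k, MeasurableSet (B k) := fun k => (isOpen_openBox _ _).measurableSet
  have hv := boxSize_pos (lam := lam) hx hR
  have hRk : ∀ (k : ℕ) (j : Fin n), 0 < 2 ^ k * R j := fun k j => by have := hR j; positivity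
  have hBne : ∀ k, μ (B k) ≠ 0 ∧ μ (B k) ≠ ∞ := fun k => laguerreMeasure_openBox_ne hlam hx (hRk k)
  have hpt : ∀ y, ENNReal.ofReal (boxDecay (m + 2) R x y) ≤
      ∑' k, (B k).indicator (fun _ => ENNReal.ofReal (2 ^ (m + 2) * C * boxSize lam x R) *
        (4⁻¹ ^ k * (μ (B k))⁻¹)) y := by
    intro y
    obtain ⟨k, hyk, hk⟩ := exists_mem_openBox_boxDecay_le (m + 2) hR x y
    refine le_trans ?_ (ENNReal.le_tsum k)
    rw [indicator_of_mem (show y ∈ B k from hyk), ← mul_assoc, ← div_eq_mul_inv,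
      ENNReal.le_div_iff_mul_le (Or.inl (hBne k).1) (Or.inl (hBne k).2)]
    calc ENNReal.ofReal (boxDecay (m + 2) R x y) * μ (B k)
        ≤ ENNReal.ofReal (2 ^ (m + 2) * ((2 ^ k) ^ (m + 2))⁻¹) *
          ENNReal.ofReal (C * ((2 ^ k) ^ m * boxSize lam x R)) := by
          refine mul_le_mul' (ENNReal.ofReal_le_ofReal hk) ((hμ x _ hx (hRk k)).2.trans ?_)
          refine ENNReal.ofReal_le_ofReal (mul_le_mul_of_nonneg_left ?_ hC.le)
          exact hm x R (2 ^ k) hx hR (one_le_pow₀ one_le_two)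
      _ = ENNReal.ofReal (2 ^ (m + 2) * C * boxSize lam x R * 4⁻¹ ^ k) := by
          rw [← ENNReal.ofReal_mul (by positivity)]
          congr 1
          rw [inv_pow, show (4 : ℝ) ^ k = (2 ^ k) ^ 2 by rw [← pow_mul, mul_comm, pow_mul]; norm_num]
          field_simp
          ring
      _ = _ := by
          rw [ENNReal.ofReal_mul (by positivity), ENNReal.ofReal_pow (by norm_num),
            ENNReal.ofReal_inv_of_pos (by norm_num)]
          norm_num
  calc ∫⁻ y, ENNReal.ofReal (boxDecay (m + 2) R x y) * h y ∂μ
      ≤ ∫⁻ y, ∑' k, (B k).indicator (fun y => ENNReal.ofReal (2 ^ (m + 2) * C * boxSize lam x R) *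
        (4⁻¹ ^ k * (μ (B k))⁻¹) * h y) y ∂μ := by
        refine lintegral_mono fun y => ?_
        refine (mul_le_mul' (hpt y) le_rfl).trans_eq ?_
        rw [← ENNReal.tsum_mul_right]
        refine tsum_congr fun k => ?_
        by_cases hy : y ∈ B k
        · simp [hy]
        · simp [hy]
    _ = ∑' k, ∫⁻ y, (B k).indicator (fun y => ENNReal.ofReal (2 ^ (m + 2) * C * boxSize lam x R) *
        (4⁻¹ ^ k * (μ (B k))⁻¹) * h y) y ∂μ :=
        lintegral_tsum fun k => (hh.const_mul _).indicator (hBm k)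
    _ = _ := by
        rw [dyadicAverage, ← ENNReal.tsum_mul_left]
        refine tsum_congr fun k => ?_
        rw [lintegral_indicator (hBm k), lintegral_const_mul'' _ hh.restrict]
        ring

theorem exists_laguerreKernel_le {n : ℕ} {lam : Fin n → ℝ} (hlam : ∀ j, -(1 / 2 : ℝ) < lam j)
    (N : ℕ) :
    ∃ C : ℝ, 0 < C ∧ ∀ s x y : Fin n → ℝ, (∀ j, 0 < s j) → (∀ j, 0 < x j) → (∀ j, 0 < y j) →
      laguerreKernel lam s x y ≤
        C / boxSize lam x (fun j => heatScale (s j)) *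
          boxDecay N (fun j => heatScale (s j)) x y := by
  choose C hC h using fun j => exists_laguerreKernel1_le (hlam j) N
  refine ⟨∏ j, C j, Finset.prod_pos fun j _ => hC j, fun s x y hs hx hy => ?_⟩
  rw [boxSize, boxDecay, ← Finset.prod_div_distrib, ← Finset.prod_mul_distrib]
  refine Finset.prod_le_prod (fun j _ => laguerreKernel1_nonneg (hlam j) (hs j) (hx j) (hy j))
    fun j _ => ?_
  rw [← div_eq_mul_inv]
  exact h j (s j) (x j) (y j) (hs j) (hx j) (hy j)

theorem laguerreKernel_nonneg {n : ℕ} {lam : Fin n → ℝ} (hlam : ∀ j, -(1 / 2 : ℝ) < lam j)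
    {s x y : Fin n → ℝ} (hs : ∀ j, 0 < s j) (hx : ∀ j, 0 < x j) (hy : ∀ j, 0 < y j) :
    0 ≤ laguerreKernel lam s x y :=
  Finset.prod_nonneg fun j _ => laguerreKernel1_nonneg (hlam j) (hs j) (hx j) (hy j)

theorem continuousOn_laguerreKernel {n : ℕ} {lam : Fin n → ℝ} (hlam : ∀ j, -(1 / 2 : ℝ) < lam j)
    {s : Fin n → ℝ} (hs : ∀ j, 0 < s j) :
    ContinuousOn (fun z : (Fin n → ℝ) × (Fin n → ℝ) => laguerreKernel lam s z.1 z.2)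
      (positiveOrthant n ×ˢ positiveOrthant n) := by
  refine continuousOn_finsetProd _ fun j _ => ?_
  exact (continuousOn_laguerreKernel1 (hlam j) (hs j)).comp
    (f := fun z : (Fin n → ℝ) × (Fin n → ℝ) => (z.1 j, z.2 j)) (by fun_prop)
    fun z hz => ⟨hz.1 j, hz.2 j⟩

/-! ### Absolute convergence and continuity of the heat integrals -/

section heat

variable {𝕜 : Type*} [RCLike 𝕜] {n : ℕ} {lam : Fin n → ℝ}

theorem aestronglyMeasurable_laguerreKernel (hlam : ∀ j, -(1 / 2 : ℝ) < lam j)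
    {s x : Fin n → ℝ} (hs : ∀ j, 0 < s j) (hx : ∀ j, 0 < x j) :
    AEStronglyMeasurable (fun y => laguerreKernel lam s x y) (laguerreMeasure lam) := by
  have hc : ContinuousOn (fun y => laguerreKernel lam s x y) (positiveOrthant n) :=
    (continuousOn_laguerreKernel hlam hs).comp (f := fun y => (x, y)) (by fun_prop)
      fun y hy => ⟨hx, hy⟩
  have h := hc.aestronglyMeasurable (μ := laguerreMeasure lam)
    (isOpen_positiveOrthant n).measurableSet
  rwa [Measure.restrict_eq_self_of_ae_mem (ae_mem_positiveOrthant lam)] at h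

/-- No duality is needed: for finite p, |f| is at most 1 or at most |f|^p, and the profile is
bounded by 1 and integrable, since the averages of the constant 1 sum to at most 2. -/
theorem lintegral_boxDecay_mul_enorm_lt_top {N : ℕ} {C : ℝ} {x R : Fin n → ℝ}
    (hR : ∀ j, 0 < R j)
    (hN : ∀ h : (Fin n → ℝ) → ℝ≥0∞, AEMeasurable h (laguerreMeasure lam) →
      ∫⁻ y, ENNReal.ofReal (boxDecay N R x y) * h y ∂laguerreMeasure lam ≤
        ENNReal.ofReal (C * boxSize lam x R) * dyadicAverage (laguerreMeasure lam) R h x)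
    {p : ℝ≥0∞} (hp : 1 ≤ p) {f : (Fin n → ℝ) → 𝕜} (hf : MemLp f p (laguerreMeasure lam)) :
    ∫⁻ y, ENNReal.ofReal (boxDecay N R x y) * ‖f y‖ₑ ∂laguerreMeasure lam < ∞ := by
  have hbdd : ∀ (h : (Fin n → ℝ) → ℝ≥0∞) (c : ℝ≥0∞), AEMeasurable h (laguerreMeasure lam) →
      c ≠ ∞ → (∀ᵐ y ∂laguerreMeasure lam, h y ≤ c) →
      ∫⁻ y, ENNReal.ofReal (boxDecay N R x y) * h y ∂laguerreMeasure lam < ∞ := by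
    intro h c hh hc hle
    refine (hN h hh).trans_lt (ENNReal.mul_lt_top ENNReal.ofReal_lt_top ?_)
    exact (dyadicAverage_le_of_ae_le hle).trans_lt
      (ENNReal.mul_lt_top (by simp) (lt_top_iff_ne_top.2 hc))
  rcases eq_or_ne p ∞ with rfl | hpt
  · refine hbdd _ (eLpNorm f ∞ (laguerreMeasure lam)) hf.1.enorm hf.2.ne ?_
    rw [eLpNorm_exponent_top]
    exact ae_le_eLpNormEssSup
  · have hp1 : 1 ≤ p.toReal := by
      rw [← ENNReal.toReal_one]
      exact ENNReal.toReal_mono hpt hp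
    have hfin := lintegral_rpow_enorm_lt_top_of_eLpNorm_lt_top (by positivity) hpt hf.2
    calc ∫⁻ y, ENNReal.ofReal (boxDecay N R x y) * ‖f y‖ₑ ∂laguerreMeasure lam
        ≤ ∫⁻ y, (ENNReal.ofReal (boxDecay N R x y) * 1 + ‖f y‖ₑ ^ p.toReal)
          ∂laguerreMeasure lam := by
          refine lintegral_mono fun y => ?_
          have h1 : ENNReal.ofReal (boxDecay N R x y) ≤ 1 := by
            rw [← ENNReal.ofReal_one]
            exact ENNReal.ofReal_le_ofReal (boxDecay_le_one hR)
          rcases le_total ‖f y‖ₑ 1 with h | h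
          · exact le_add_right (mul_le_mul' le_rfl h)
          · refine le_add_left ?_
            calc _ ≤ 1 * ‖f y‖ₑ := mul_le_mul' h1 le_rfl
              _ = ‖f y‖ₑ := one_mul _
              _ ≤ _ := ENNReal.le_rpow_self_of_one_le h hp1
      _ = ∫⁻ y, ENNReal.ofReal (boxDecay N R x y) * 1 ∂laguerreMeasure lam +
          ∫⁻ y, ‖f y‖ₑ ^ p.toReal ∂laguerreMeasure lam :=
          lintegral_add_left' (((continuous_boxDecay hR).measurable.ennreal_ofReal.mul_const
            1).aemeasurable) _
      _ < ∞ := ENNReal.add_lt_top.2 ⟨hbdd _ 1 aemeasurable_const (by simp) (by simp), hfin⟩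

theorem enorm_laguerreKernel_smul_le {N : ℕ} {C : ℝ} (hlam : ∀ j, -(1 / 2 : ℝ) < lam j)
    (hK : ∀ s x y : Fin n → ℝ, (∀ j, 0 < s j) → (∀ j, 0 < x j) → (∀ j, 0 < y j) →
      laguerreKernel lam s x y ≤
        C / boxSize lam x (fun j => heatScale (s j)) *
          boxDecay N (fun j => heatScale (s j)) x y)
    {s x y : Fin n → ℝ} (hs : ∀ j, 0 < s j) (hx : ∀ j, 0 < x j) (hy : ∀ j, 0 < y j)
    (f : (Fin n → ℝ) → 𝕜) :
    ‖laguerreKernel lam s x y • f y‖ₑ ≤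
      ENNReal.ofReal (C / boxSize lam x (fun j => heatScale (s j))) *
        (ENNReal.ofReal (boxDecay N (fun j => heatScale (s j)) x y) * ‖f y‖ₑ) := by
  rw [enorm_smul, Real.enorm_eq_ofReal (laguerreKernel_nonneg hlam hs hx hy), ← mul_assoc,
    ← ENNReal.ofReal_mul' (boxDecay_nonneg fun j => heatScale_pos (hs j))]
  exact mul_le_mul' (ENNReal.ofReal_le_ofReal (hK s x y hs hx hy)) le_rfl

theorem exists_lintegral_enorm_laguerreKernel_smul_le (𝕜 : Type*) [RCLike 𝕜]
    (hlam : ∀ j, -(1 / 2 : ℝ) < lam j) :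
    ∃ C : ℝ≥0, 0 < C ∧ ∀ s x : Fin n → ℝ, (∀ j, 0 < s j) → (∀ j, 0 < x j) →
      ∀ f : (Fin n → ℝ) → 𝕜, AEStronglyMeasurable f (laguerreMeasure lam) →
        ∫⁻ y, ‖laguerreKernel lam s x y • f y‖ₑ ∂laguerreMeasure lam ≤
          C * dyadicAverage (laguerreMeasure lam) (fun j => heatScale (s j))
            (fun y => ‖f y‖ₑ) x := by
  obtain ⟨N, C, hC, hN⟩ := exists_lintegral_boxDecay_mul_le hlam
  obtain ⟨C', hC', hK⟩ := exists_laguerreKernel_le hlam N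
  refine ⟨Real.toNNReal (C' * C), by simpa using mul_pos hC' hC, fun s x hs hx f hf => ?_⟩
  have hR : ∀ j, 0 < heatScale (s j) := fun j => heatScale_pos (hs j)
  have hv := boxSize_pos (lam := lam) hx hR
  calc ∫⁻ y, ‖laguerreKernel lam s x y • f y‖ₑ ∂laguerreMeasure lam
      ≤ ∫⁻ y, ENNReal.ofReal (C' / boxSize lam x (fun j => heatScale (s j))) *
        (ENNReal.ofReal (boxDecay N (fun j => heatScale (s j)) x y) * ‖f y‖ₑ)
          ∂laguerreMeasure lam := by
        refine lintegral_mono_ae ?_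
        filter_upwards [ae_mem_positiveOrthant lam] with y hy
        exact enorm_laguerreKernel_smul_le hlam hK hs hx hy f
    _ ≤ ENNReal.ofReal (C' / boxSize lam x (fun j => heatScale (s j))) *
        (ENNReal.ofReal (C * boxSize lam x (fun j => heatScale (s j))) *
          dyadicAverage (laguerreMeasure lam) (fun j => heatScale (s j))
            (fun y => ‖f y‖ₑ) x) := by
        rw [lintegral_const_mul' _ _ ENNReal.ofReal_ne_top]
        exact mul_le_mul' le_rfl (hN x _ hx hR _ hf.enorm)
    _ = _ := by
        rw [← mul_assoc, ← ENNReal.ofReal_mul (by positivity)]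
        rw [show C' / boxSize lam x (fun j => heatScale (s j)) *
          (C * boxSize lam x fun j => heatScale (s j)) = C' * C by field_simp]
        rfl

theorem integrable_laguerreKernel_smul (hlam : ∀ j, -(1 / 2 : ℝ) < lam j) {p : ℝ≥0∞}
    (hp : 1 ≤ p) {f : (Fin n → ℝ) → 𝕜} (hf : MemLp f p (laguerreMeasure lam))
    {s x : Fin n → ℝ} (hs : ∀ j, 0 < s j) (hx : ∀ j, 0 < x j) :
    Integrable (fun y => laguerreKernel lam s x y • f y) (laguerreMeasure lam) := by
  obtain ⟨N, C, hC, hN⟩ := exists_lintegral_boxDecay_mul_le hlam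
  obtain ⟨C', hC', hK⟩ := exists_laguerreKernel_le hlam N
  have hR : ∀ j, 0 < heatScale (s j) := fun j => heatScale_pos (hs j)
  refine ⟨(aestronglyMeasurable_laguerreKernel hlam hs hx).smul hf.1, ?_⟩
  have hfin := ENNReal.mul_lt_top
    (a := ENNReal.ofReal (C' / boxSize lam x (fun j => heatScale (s j)))) ENNReal.ofReal_lt_top
    (lintegral_boxDecay_mul_enorm_lt_top hR (hN x _ hx hR) hp hf)
  rw [← lintegral_const_mul' _ _ ENNReal.ofReal_ne_top] at hfin
  refine lt_of_le_of_lt (lintegral_mono_ae ?_) hfin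
  filter_upwards [ae_mem_positiveOrthant lam] with y hy
  exact enorm_laguerreKernel_smul_le hlam hK hs hx hy f

theorem continuousAt_boxSize {x R : Fin n → ℝ} (hx : ∀ j, 0 < x j) (hR : ∀ j, 0 < R j) :
    ContinuousAt (fun x => boxSize lam x R) x := by
  refine tendsto_finsetProd _ fun j _ => ?_
  refine ContinuousAt.mul continuousAt_const (ContinuousAt.rpow_const
    ((continuous_apply j).continuousAt.add continuousAt_const) (Or.inl ?_))
  have := hx j
  have := hR j
  positivity

/-- Dominated convergence: for x in the box of shape R around x₀ the profile at x is at most a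
constant times the one at x₀, which is integrable against |f|. Continuity in x is what makes the
uncountable supremum over t measurable. -/
theorem continuousOn_laguerreHeat (hlam : ∀ j, -(1 / 2 : ℝ) < lam j) {p : ℝ≥0∞}
    (hp : 1 ≤ p) {f : (Fin n → ℝ) → 𝕜} (hf : MemLp f p (laguerreMeasure lam))
    {s : Fin n → ℝ} (hs : ∀ j, 0 < s j) :
    ContinuousOn (laguerreHeat lam s f) (positiveOrthant n) := by
  obtain ⟨N, C, hC, hN⟩ := exists_lintegral_boxDecay_mul_le hlam
  obtain ⟨C', hC', hK⟩ := exists_laguerreKernel_le hlam N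
  have hR : ∀ j, 0 < heatScale (s j) := fun j => heatScale_pos (hs j)
  set R : Fin n → ℝ := fun j => heatScale (s j) with hRdef
  intro x₀ hx₀
  refine ContinuousAt.continuousWithinAt ?_
  have hU := (isOpen_positiveOrthant n).mem_nhds hx₀
  have hv := boxSize_pos (lam := lam) hx₀ hR
  set M : ℝ := (C' / boxSize lam x₀ R + 1) * ∏ _j : Fin n, (2 : ℝ) ^ N with hM
  have hsize : ∀ᶠ x in 𝓝 x₀, C' / boxSize lam x R ≤ C' / boxSize lam x₀ R + 1 := by
    have : ContinuousAt (fun x => C' / boxSize lam x R) x₀ :=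
      continuousAt_const.div (continuousAt_boxSize hx₀ hR) hv.ne'
    filter_upwards [this.eventually_lt_const (lt_add_one _)] with x hx using hx.le
  refine continuousAt_of_dominated (bound := fun y => M * (boxDecay N R x₀ y * ‖f y‖)) ?_ ?_ ?_ ?_
  · filter_upwards [hU] with x hx
    exact (aestronglyMeasurable_laguerreKernel hlam hs hx).smul hf.1
  · filter_upwards [hU, hsize, (isOpen_openBox x₀ R).mem_nhds (self_mem_openBox hR)]
      with x hx hxs hxR
    filter_upwards [ae_mem_positiveOrthant lam] with y hy
    rw [norm_smul, Real.norm_of_nonneg (laguerreKernel_nonneg hlam hs hx hy), ← mul_assoc]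
    refine mul_le_mul_of_nonneg_right ?_ (norm_nonneg _)
    have hxpos := boxSize_pos (lam := lam) hx hR
    refine (hK s x y hs hx hy).trans ?_
    rw [hM, mul_assoc]
    refine mul_le_mul hxs (boxDecay_le_of_near hR fun j => ?_) (boxDecay_nonneg hR) (by positivity)
    rw [abs_sub_comm]
    exact (mem_openBox.1 hxR j).le
  · refine Integrable.const_mul ⟨((continuous_boxDecay hR).aestronglyMeasurable).mul hf.1.norm, ?_⟩ _
    refine lt_of_le_of_lt (lintegral_mono fun y => le_of_eq ?_)
      (lintegral_boxDecay_mul_enorm_lt_top hR (hN x₀ _ hx₀ hR) hp hf)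
    rw [Pi.mul_apply, enorm_mul, Real.enorm_eq_ofReal (boxDecay_nonneg hR), enorm_norm]
  · filter_upwards [ae_mem_positiveOrthant lam] with y hy
    have h1 : ContinuousAt (fun z : (Fin n → ℝ) × (Fin n → ℝ) => laguerreKernel lam s z.1 z.2)
        (x₀, y) := (continuousOn_laguerreKernel hlam hs).continuousAt
          (prod_mem_nhds hU ((isOpen_positiveOrthant n).mem_nhds hy))
    have h2 : ContinuousAt (fun x => laguerreKernel lam s x y) x₀ :=
      ContinuousAt.comp (f := fun x => (x, y)) h1 (by fun_prop)
    exact h2.smul continuousAt_const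

end heat

/-! ### The maximal operator -/

section maximal

variable {𝕜 : Type*} [RCLike 𝕜] {n : ℕ} {lam : Fin n → ℝ} {r : Fin n → ℝ≥0 → ℝ≥0}

theorem aemeasurable_laguerreMaximal (hlam : ∀ j, -(1 / 2 : ℝ) < lam j)
    (hr : ∀ j, IsTimeChange (r j)) {p : ℝ≥0∞} (hp : 1 ≤ p) {f : (Fin n → ℝ) → 𝕜}
    (hf : MemLp f p (laguerreMeasure lam)) :
    AEMeasurable (laguerreMaximal lam r f) (laguerreMeasure lam) := by
  -- Continuity is known only on the orthant, which carries the measure. Cut off outside it, the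
  -- superlevel sets are unions of open sets.
  refine ⟨(positiveOrthant n).indicator (laguerreMaximal lam r f), measurable_of_Ioi fun a => ?_,
    ?_⟩
  · have e : (positiveOrthant n).indicator (laguerreMaximal lam r f) ⁻¹' Ioi a =
        ⋃ (t : ℝ≥0) (_ : 0 < t), positiveOrthant n ∩
          (fun x => ‖laguerreHeat lam (fun j => (r j t : ℝ)) f x‖ₑ) ⁻¹' Ioi a := by
      ext x
      by_cases hx : x ∈ positiveOrthant n
      · simp [hx, laguerreMaximal, lt_iSup_iff]
      · simp [hx]
    rw [e]
    refine (isOpen_iUnion fun t => isOpen_iUnion fun ht => ?_).measurableSet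
    refine ContinuousOn.isOpen_inter_preimage ?_ (isOpen_positiveOrthant n) isOpen_Ioi
    exact (continuousOn_laguerreHeat hlam hp hf fun j => by exact_mod_cast (hr j).pos t ht).enorm
  · filter_upwards [ae_mem_positiveOrthant lam] with x hx
    rw [indicator_of_mem hx]

theorem exists_laguerreMaximal_le (𝕜 : Type*) [RCLike 𝕜] (hlam : ∀ j, -(1 / 2 : ℝ) < lam j)
    (hr : ∀ j, IsTimeChange (r j)) :
    ∃ C : ℝ≥0, 0 < C ∧ ∀ f : (Fin n → ℝ) → 𝕜, AEStronglyMeasurable f (laguerreMeasure lam) →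
      ∀ x ∈ positiveOrthant n, laguerreMaximal lam r f x ≤
        C * ⨆ t : {t : ℝ≥0 // 0 < t}, dyadicAverage (laguerreMeasure lam)
          (fun j => heatScale (r j t)) (fun y => ‖f y‖ₑ) x := by
  obtain ⟨C, hC, h⟩ := exists_lintegral_enorm_laguerreKernel_smul_le 𝕜 hlam
  refine ⟨C, hC, fun f hf x hx => iSup₂_le fun t ht => ?_⟩
  calc ‖laguerreHeat lam (fun j => (r j t : ℝ)) f x‖ₑ
      ≤ ∫⁻ y, ‖laguerreKernel lam (fun j => (r j t : ℝ)) x y • f y‖ₑ ∂laguerreMeasure lam :=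
        enorm_integral_le_lintegral_enorm _
    _ ≤ _ := h _ x (fun j => by exact_mod_cast (hr j).pos t ht) hx f hf
    _ ≤ _ := mul_le_mul' le_rfl (le_iSup (fun t : {t : ℝ≥0 // 0 < t} =>
        dyadicAverage (laguerreMeasure lam) (fun j => heatScale (r j t)) (fun y => ‖f y‖ₑ) x)
          ⟨t, ht⟩)

/-- The part of |f| below the height a contributes at most 2a to each dyadic average. If some dyadic
average of |f| exceeds 3a, that of the part above a exceeds a; hence A is three times the domination
constant. -/
theorem exists_laguerreMaximal_localized_weak_type (𝕜 : Type*) [RCLike 𝕜]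
    (hlam : ∀ j, -(1 / 2 : ℝ) < lam j) (hr : ∀ j, IsTimeChange (r j)) :
    ∃ A C : ℝ≥0, 0 < A ∧ ∀ f : (Fin n → ℝ) → 𝕜, AEStronglyMeasurable f (laguerreMeasure lam) →
      ∀ a : ℝ≥0, 0 < a →
        a * laguerreMeasure lam {x | (A * a : ℝ≥0∞) < laguerreMaximal lam r f x} ≤
          C * ∫⁻ x in {x | (a : ℝ≥0∞) < ‖f x‖ₑ}, ‖f x‖ₑ ∂laguerreMeasure lam := by
  obtain ⟨C, hC, h⟩ := exists_laguerreMaximal_le 𝕜 (r := r) hlam hr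
  obtain ⟨D, hD⟩ := exists_laguerreMeasure_doubling hlam
  refine ⟨C * 3, 4 * D, by positivity, fun f hf a ha => ?_⟩
  set μ := laguerreMeasure lam with hμ
  have hnull : NullMeasurableSet {x | (a : ℝ≥0∞) < ‖f x‖ₑ} μ :=
    nullMeasurableSet_lt aemeasurable_const hf.enorm
  set R : {t : ℝ≥0 // 0 < t} → Fin n → ℝ := fun t j => heatScale (r j t) with hR
  set g : (Fin n → ℝ) → ℝ≥0∞ := {x | (a : ℝ≥0∞) < ‖f x‖ₑ}.indicator fun x => ‖f x‖ₑ with hg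
  have hsplit : ∀ x, ‖f x‖ₑ ≤ g x + a := by
    intro x
    by_cases hx : (a : ℝ≥0∞) < ‖f x‖ₑ
    · rw [hg, indicator_of_mem (show x ∈ {x | (a : ℝ≥0∞) < ‖f x‖ₑ} from hx)]
      exact le_self_add
    · exact le_add_left (not_lt.1 hx)
  have hsub : {x | ((C * 3 : ℝ≥0) * a : ℝ≥0∞) < laguerreMaximal lam r f x} ≤ᵐ[μ]
      {x ∈ positiveOrthant n | ∃ t, (a : ℝ≥0∞) < dyadicAverage μ (R t) g x} := by
    filter_upwards [ae_mem_positiveOrthant lam] with x hx hlt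
    refine ⟨hx, ?_⟩
    have h1 : (C : ℝ≥0∞) * (3 * a) < C * ⨆ t, dyadicAverage μ (R t) (fun y => ‖f y‖ₑ) x := by
      refine lt_of_lt_of_le ?_ (h f hf x hx)
      have : ((C * 3 : ℝ≥0) * a : ℝ≥0∞) < laguerreMaximal lam r f x := hlt
      push_cast at this
      rwa [mul_assoc] at this
    have h2 := lt_of_mul_lt_mul_left' h1
    obtain ⟨t, ht⟩ := lt_iSup_iff.1 h2
    refine ⟨t, ?_⟩
    have h3 : dyadicAverage μ (R t) (fun y => ‖f y‖ₑ) x ≤ dyadicAverage μ (R t) g x + 2 * a := by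
      calc dyadicAverage μ (R t) (fun y => ‖f y‖ₑ) x
          ≤ dyadicAverage μ (R t) (fun y => g y + a) x := by
            refine ENNReal.tsum_le_tsum fun k => mul_le_mul' le_rfl (mul_le_mul' le_rfl ?_)
            exact lintegral_mono hsplit
        _ = dyadicAverage μ (R t) g x + dyadicAverage μ (R t) (fun _ => (a : ℝ≥0∞)) x :=
            dyadicAverage_add_le aemeasurable_const
        _ ≤ _ := by
            gcongr
            exact dyadicAverage_le_of_ae_le (ae_of_all _ fun _ => le_rfl)
    have h4 := ht.trans_le h3
    rw [show (3 * a : ℝ≥0∞) = a + 2 * a by ring] at h4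
    exact lt_of_add_lt_add_right h4
  calc (a : ℝ≥0∞) * μ {x | ((C * 3 : ℝ≥0) * a : ℝ≥0∞) < laguerreMaximal lam r f x}
      ≤ a * μ {x ∈ positiveOrthant n | ∃ t, (a : ℝ≥0∞) < dyadicAverage μ (R t) g x} :=
        mul_le_mul' le_rfl (measure_mono_ae hsub)
    _ ≤ 4 * D * ∫⁻ y, g y ∂μ := by
        -- Monotonicity of every r_j in the common parameter t makes the boxes totally ordered, and
        -- `heatScale` ≤ 1 gives the uniform bound on sizes that Vitali's lemma requires.
        refine mul_measure_exists_dyadicAverage_gt_le μ (fun x hx R hR => hD x R hx hR)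
          (fun x hx R hR => laguerreMeasure_openBox_ne hlam hx hR) R
          (fun t j => heatScale_pos (by exact_mod_cast (hr j).pos t t.2)) (fun s t => ?_) (M := 1)
          (fun t j => heatScale_le_one _) g a
        exact (le_total s t).imp
          (fun hst j => heatScale_mono (by exact_mod_cast (hr j).monotone hst))
          (fun hst j => heatScale_mono (by exact_mod_cast (hr j).monotone hst))
    _ = _ := by
        rw [hg, lintegral_indicator₀ hnull]
        push_cast
        rfl

end maximal

end

/-! ### Proof of the theorem -/

theorem theorem1p3 {𝕜 : Type*} [RCLike 𝕜] {n : ℕ} (lam : Fin n → ℝ)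
    (hlam : ∀ j, -(1 / 2 : ℝ) < lam j) (r : Fin n → ℝ≥0 → ℝ≥0) (hr : ∀ j, IsTimeChange (r j)) :
    -- the integral defining `L_{r(t)} f (x)` converges absolutely for `f` in `L^p`, `1 ≤ p ≤ ∞`
    (∀ p : ℝ≥0∞, 1 ≤ p → ∀ f : (Fin n → ℝ) → 𝕜, MemLp f p (laguerreMeasure lam) →
      ∀ t : ℝ≥0, 0 < t → ∀ x : Fin n → ℝ, (∀ j, 0 < x j) →
        Integrable (fun y => laguerreKernel lam (fun j => (r j t : ℝ)) x y • f y)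
          (laguerreMeasure lam)) ∧
    -- boundedness on `L^p`, `1 < p ≤ ∞`
    (∀ p : ℝ≥0∞, 1 < p → ∃ C : ℝ≥0, ∀ f : (Fin n → ℝ) → 𝕜, MemLp f p (laguerreMeasure lam) →
      MemLp (laguerreMaximal lam r f) p (laguerreMeasure lam) ∧
      eLpNorm (laguerreMaximal lam r f) p (laguerreMeasure lam) ≤
        C * eLpNorm f p (laguerreMeasure lam)) ∧
    -- boundedness from `L^1` into `L^{1,∞}`
    (∃ C : ℝ≥0, ∀ f : (Fin n → ℝ) → 𝕜, MemLp f 1 (laguerreMeasure lam) →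
      AEMeasurable (laguerreMaximal lam r f) (laguerreMeasure lam) ∧
      ∀ α : ℝ≥0, 0 < α →
        laguerreMeasure lam {x | (α : ℝ≥0∞) < laguerreMaximal lam r f x} ≤
          C * eLpNorm f 1 (laguerreMeasure lam) / α) := by
  refine ⟨fun p hp f hf t ht x hx => integrable_laguerreKernel_smul hlam hp hf
    (fun j => by exact_mod_cast (hr j).pos t ht) hx, fun p hp => ?_, ?_⟩
  · suffices hbound : ∃ C : ℝ≥0, ∀ f : (Fin n → ℝ) → 𝕜, MemLp f p (laguerreMeasure lam) →
        eLpNorm (laguerreMaximal lam r f) p (laguerreMeasure lam) ≤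
          C * eLpNorm f p (laguerreMeasure lam) by
      obtain ⟨C, hC⟩ := hbound
      refine ⟨C, fun f hf => ⟨⟨(aemeasurable_laguerreMaximal hlam hr hp.le
        hf).aestronglyMeasurable, ?_⟩, hC f hf⟩⟩
      exact (hC f hf).trans_lt (ENNReal.mul_lt_top ENNReal.coe_lt_top hf.2)
    rcases eq_or_ne p ∞ with rfl | hpt
    · obtain ⟨C, -, h⟩ := exists_laguerreMaximal_le 𝕜 (r := r) hlam hr
      refine ⟨C * 2, fun f hf => ?_⟩
      rw [eLpNorm_exponent_top, eLpNorm_exponent_top]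
      refine eLpNormEssSup_le_of_ae_enorm_bound ?_
      filter_upwards [ae_mem_positiveOrthant lam] with x hx
      rw [enorm_eq_self]
      push_cast
      rw [mul_assoc]
      refine (h f hf.1 x hx).trans (mul_le_mul' le_rfl (iSup_le fun t => ?_))
      exact dyadicAverage_le_of_ae_le ae_le_eLpNormEssSup
    · obtain ⟨A, C, hA, h⟩ := exists_laguerreMaximal_localized_weak_type 𝕜 (r := r) hlam hr
      have hp0 : p ≠ 0 := (zero_lt_one.trans hp).ne'
      have hq : 1 < p.toReal := by
        rw [← ENNReal.toReal_one]
        exact ENNReal.toReal_strict_mono hpt hp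
      have hq0 : 0 < p.toReal := by linarith
      set K : ℝ≥0∞ := (A : ℝ≥0∞) ^ p.toReal *
        (ENNReal.ofReal p.toReal * (C * (ENNReal.ofReal (p.toReal - 1))⁻¹)) with hK
      have hKtop : K ≠ ∞ := by
        refine ENNReal.mul_ne_top (ENNReal.rpow_ne_top_of_nonneg hq0.le ENNReal.coe_ne_top)
          (ENNReal.mul_ne_top ENNReal.ofReal_ne_top (ENNReal.mul_ne_top ENNReal.coe_ne_top ?_))
        simpa using hq
      have hKtop' : K ^ (1 / p.toReal) ≠ ∞ :=
        ENNReal.rpow_ne_top_of_nonneg (by positivity) hKtop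
      refine ⟨(K ^ (1 / p.toReal)).toNNReal, fun f hf => ?_⟩
      rw [ENNReal.coe_toNNReal hKtop', eLpNorm_eq_lintegral_rpow_enorm_toReal hp0 hpt,
        eLpNorm_eq_lintegral_rpow_enorm_toReal hp0 hpt,
        ← ENNReal.mul_rpow_of_nonneg _ _ (by positivity)]
      refine ENNReal.rpow_le_rpow ?_ (by positivity)
      simp only [enorm_eq_self]
      exact lintegral_rpow_le_of_localized_weak_type
        (aemeasurable_laguerreMaximal hlam hr hp.le hf) hf.1.enorm (fun x => enorm_lt_top) hA
        (h f hf.1) hq (lintegral_rpow_enorm_lt_top_of_eLpNorm_lt_top hp0 hpt hf.2).ne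
  · obtain ⟨A, C, hA, h⟩ := exists_laguerreMaximal_localized_weak_type 𝕜 (r := r) hlam hr
    refine ⟨A * C, fun f hf => ⟨aemeasurable_laguerreMaximal hlam hr le_rfl hf, fun α hα => ?_⟩⟩
    -- The height α/A makes the localized superlevel set exactly {maximal function > α}.
    have h1 := h f hf.1 (α / A) (by positivity)
    have hA0 : (A : ℝ≥0∞) ≠ 0 := by exact_mod_cast hA.ne'
    have e : (A * (α / A : ℝ≥0) : ℝ≥0∞) = α := by
      rw [← ENNReal.coe_mul, mul_div_cancel₀ _ hA.ne']
    rw [e] at h1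
    rw [ENNReal.le_div_iff_mul_le (Or.inl (by exact_mod_cast hα.ne')) (Or.inl ENNReal.coe_ne_top),
      eLpNorm_one_eq_lintegral_enorm, mul_comm]
    nth_rw 1 [← e]
    rw [mul_assoc]
    push_cast
    rw [mul_assoc]
    refine mul_le_mul' le_rfl (le_trans ?_ (mul_le_mul' le_rfl (setLIntegral_le_lintegral
      {x | ((α / A : ℝ≥0) : ℝ≥0∞) < ‖f x‖ₑ} _)))
    exact_mod_cast h1
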